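/- **Setting.** Let $X,\partial X,\partial Y$ be complex Banach spaces, with $\partial Y$ continuously embedded in $\partial X$. Let $A:D(A)\subset X\to X$ be linear, let $L:D(A)\to\partial Y$ be linear and surjective, and let $\binom{A}{L}$ be closed as an operator from $X$ to $X\times\partial Y$. Put $A_0:=A|_{\ker L}$. Let $D:D(D)\subset\partial X\to\partial X$, $B:D(B)\subset\partial X\to X$ and $C:D(C)\subset X\to\partial X$ be linear with $D(D)\subset D(B)$ and $D(A)\subset D(C)$, and suppose that $C=0$. On $\mathbf X:=X\times\partial X$ consider the operator matrix with coupled domain $$\mathbf A:=\begin{pmatrix}A&B\\ C&D\end{pmatrix},\qquad D(\mathbf A):=\left\{\binom{u}{x}\in D(A)\times(D(D)\cap\partial Y):\ Lu=x\right\}.$$ Suppose that $A_0$ is invertible, i.e. $0\in\rho(A_0)$. Then for each $x\in\partial Y$ the problem $Au=0$, $Lu=x$ has a unique solution $u=:D_0^{A,L}x$. Suppose that $D_0^{A,L}$ extends to a bounded operator $\overline{D_0^{A,L}}:\partial X\to X$, and that $B-\overline{D_0^{A,L}}D$, defined on $D(D)\cap\partial Y$, is bounded from $\partial X$ to $X$,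 i.e. $\|Bx-\overline{D_0^{A,L}}Dx\|_X\le K\|x\|_{\partial X}$ for some constant $K$ and all $x\in D(D)\cap\partial Y$. Let $A_0$ generate a bounded $C_0$-semigroup $(e^{tA_0})_{t\ge0}$ on $X$, and let $D$, with domain $D(D)\cap\partial Y$ (that is, $D$ itself when $D(D)\subset\partial Y$), generate a uniformly exponentially stable $C_0$-semigroup $(e^{tD})_{t\ge0}$ on $\partial X$. **Claim.** $B-\overline{D_0^{A,L}}D$ has a unique extension to a bounded operator $G:\partial X\to X$, the operator $\mathbf A$ generates a $C_0$-semigroup on $\mathbf X$, and $$e^{t\mathbf A}=\begin{pmatrix}e^{tA_0}&S(t)\\0&e^{tD}\end{pmatrix},\qquad S(t)=V(t)+\overline{D_0^{A,L}}e^{tD}-e^{tA_0}\overline{D_0^{A,L}},\qquad V(t)y=\int_0^te^{(t-s)A_0}Ge^{sD}y\,ds,\qquad t\ge0,\ y\in\partial X.$$ Moreover: 1. $(e^{t\mathbf A})_{t\ge0}$ is bounded. 2. If $(e^{tA_0})_{t\ge0}$ is asymptotically almost periodic, then so are $(V(t))_{t\ge0}$, $(S(t))_{t\ge0}$ and $(e^{t\mathbf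 A})_{t\ge0}$. 3. If $\lim_{t\to\infty}e^{tA_0}$ exists (resp. exists and equals $0$) in the strong operator topology, then $\lim_{t\to\infty}e^{t\mathbf A}$ exists (resp. exists and equals $0$) in the strong operator topology. 4. If $(e^{tA_0})_{t\ge0}$ is uniformly exponentially stable, then so is $(e^{t\mathbf A})_{t\ge0}$. Here an operator family on $[0,\infty)$ is called asymptotically almost periodic if each of its orbits is the sum of a continuous function vanishing at infinity and a uniform limit on $[0,\infty)$ of vector-valued trigonometric polynomials, i.e. of finite linear combinations of functions $t\mapsto e^{i\eta t}x$ with $\eta\in\mathbb R$. -/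

import Mathlib

open Filter Topology

namespace CoupledMatrix

/-! ### Strongly continuous semigroups and their asymptotics -/

section Semigroups

variable {E : Type*} [NormedAddCommGroup E] [NormedSpace ℂ E]

/-- `T` (only its values at times `t ≥ 0` matter) is a strongly continuous semigroup of bounded
linear operators on `E`. -/
structure IsC0Semigroup (T : ℝ → E →L[ℂ] E) : Prop where
  map_zero : T 0 = ContinuousLinearMap.id ℂ E
  map_add : ∀ s t : ℝ, 0 ≤ s → 0 ≤ t → T (s + t) = (T s).comp (T t)
  strongly_continuous : ∀ x : E, ContinuousOn (fun t => T t x) (Set.Ici 0)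

/-- The unbounded operator `G` generates the `C₀`-semigroup `T`: the pair `(x, y)` lies in the
graph of `G` exactly when `(T t x - x) / t → y` as `t ↓ 0`. -/
def Generates (G : E →ₗ.[ℂ] E) (T : ℝ → E →L[ℂ] E) : Prop :=
  IsC0Semigroup T ∧
    ∀ x y : E, (x, y) ∈ G.graph ↔
      Tendsto (fun t : ℝ => ((t⁻¹ : ℝ) : ℂ) • (T t x - x)) (𝓝[>] 0) (𝓝 y)

/-- `(T t)_{t ≥ 0}` is bounded in operator norm. -/
def IsBoundedSemigroup (T : ℝ → E →L[ℂ] E) : Prop :=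
  ∃ M : ℝ, ∀ t : ℝ, 0 ≤ t → ‖T t‖ ≤ M

/-- Uniform exponential stability: `‖T t‖ ≤ M exp (-ω t)` for `t ≥ 0` with some `ω > 0`. -/
def IsUniformlyExpStable (T : ℝ → E →L[ℂ] E) : Prop :=
  ∃ M ω : ℝ, 0 < ω ∧ ∀ t : ℝ, 0 ≤ t → ‖T t‖ ≤ M * Real.exp (-ω * t)

/-- `T t` converges to some bounded operator, strongly, as `t → ∞`. -/
def StrongLimitExists (T : ℝ → E →L[ℂ] E) : Prop :=
  ∃ P : E →L[ℂ] E, ∀ x : E, Tendsto (fun t => T t x) atTop (𝓝 (P x))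

/-- `T t` converges to `0`, strongly, as `t → ∞`. -/
def StrongLimitZero (T : ℝ → E →L[ℂ] E) : Prop :=
  ∀ x : E, Tendsto (fun t => T t x) atTop (𝓝 0)

variable (E) in
/-- The `E`-valued trigonometric polynomials: the linear span of `t ↦ exp (i η t) • x`. -/
def trigPolynomials : Submodule ℂ (ℝ → E) :=
  Submodule.span ℂ {f | ∃ (η : ℝ) (x : E), f = fun t : ℝ => Complex.exp (Complex.I * η * t) • x}

/-- Almost periodic functions on the half-line: uniform limits on `[0, ∞)` of trigonometric
polynomials. -/
def IsAlmostPeriodic (f : ℝ → E) : Prop :=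
  ∀ ε : ℝ, 0 < ε → ∃ p ∈ trigPolynomials E, ∀ t : ℝ, 0 ≤ t → ‖f t - p t‖ ≤ ε

/-- Asymptotically almost periodic functions on the half-line: sums of an almost periodic
function and a continuous function vanishing at infinity. -/
def IsAsymptoticallyAlmostPeriodic (f : ℝ → E) : Prop :=
  ∃ g h : ℝ → E, IsAlmostPeriodic g ∧ ContinuousOn h (Set.Ici 0) ∧ Tendsto h atTop (𝓝 0) ∧
    ∀ t : ℝ, 0 ≤ t → f t = g t + h t

/-- An operator family on the half-line is asymptotically almost periodic if all its orbits are. -/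
def IsAsymptoticallyAlmostPeriodicFamily {F : Type*} (S : ℝ → F → E) : Prop :=
  ∀ x : F, IsAsymptoticallyAlmostPeriodic (fun t => S t x)

end Semigroups

/-! ### Resolvent set and the abstract Dirichlet problem -/

section Operators

variable {X Yb : Type*} [NormedAddCommGroup X] [NormedSpace ℂ X]
  [NormedAddCommGroup Yb] [NormedSpace ℂ Yb]

/-- The resolvent set of an unbounded operator `G` on `X`: all `μ` such that
`μ - G : D(G) → X` has a bounded everywhere defined two-sided inverse. -/
def resolvSet (G : X →ₗ.[ℂ] X) : Set ℂ :=
  {μ | ∃ R : X →L[ℂ] X,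
    (∀ f : X, ∃ h : R f ∈ G.domain, μ • R f - G ⟨R f, h⟩ = f) ∧
    ∀ u : G.domain, R (μ • (u : X) - G u) = u}

/-- The restriction of `A` to `ker L`. -/
def restrictKer (A : X →ₗ.[ℂ] X) (L : A.domain →ₗ[ℂ] Yb) : X →ₗ.[ℂ] X :=
  A.domRestrict ((LinearMap.ker L).map A.domain.subtype)

/-- The operator `u ↦ (A u, L u)` from `X` to `X × ∂Y`, with domain `D(A)`. -/
def stacked (A : X →ₗ.[ℂ] X) (L : A.domain →ₗ[ℂ] Yb) : X →ₗ.[ℂ] X × Yb :=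
  ⟨A.domain, A.toFun.prod L⟩

/-- `u` solves the abstract eigenvalue Dirichlet problem `A u = μ u`, `L u = x`. -/
def IsDirichletSolution (A : X →ₗ.[ℂ] X) (L : A.domain →ₗ[ℂ] Yb) (μ : ℂ) (x : Yb) (u : X) :
    Prop :=
  ∃ h : u ∈ A.domain, A ⟨u, h⟩ = μ • u ∧ L ⟨u, h⟩ = x

/-- The Dirichlet operator, mapping `x ∈ ∂Y` to the solution of the abstract Dirichlet problem
(unique for `μ` in the resolvent set of `A₀`, see below). -/
noncomputable def dirichletOp (A : X →ₗ.[ℂ] X) (L : A.domain →ₗ[ℂ] Yb) (μ : ℂ) (x : Yb) : X :=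
  Classical.epsilon (IsDirichletSolution A L μ x)

theorem mem_restrictKer_domain {A : X →ₗ.[ℂ] X} {L : A.domain →ₗ[ℂ] Yb} {u : X} :
    u ∈ (restrictKer A L).domain ↔ ∃ h : u ∈ A.domain, L ⟨u, h⟩ = 0 := by
  simp only [restrictKer, LinearPMap.domRestrict_domain, Submodule.mem_inf, Submodule.mem_map,
    LinearMap.mem_ker]
  constructor
  · rintro ⟨⟨v, hv, rfl⟩, h⟩
    exact ⟨h, hv⟩
  · rintro ⟨h, hL⟩
    exact ⟨⟨⟨u, h⟩, hL, rfl⟩, h⟩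

theorem restrictKer_apply {A : X →ₗ.[ℂ] X} {L : A.domain →ₗ[ℂ] Yb} {u : X}
    (h : u ∈ (restrictKer A L).domain) (h' : u ∈ A.domain) :
    restrictKer A L ⟨u, h⟩ = A ⟨u, h'⟩ :=
  LinearPMap.domRestrict_apply rfl

theorem existsUnique_dirichletSolution {A : X →ₗ.[ℂ] X} {L : A.domain →ₗ[ℂ] Yb}
    (hL : Function.Surjective L) {μ : ℂ} (hμ : μ ∈ resolvSet (restrictKer A L)) (x : Yb) :
    ∃! u : X, IsDirichletSolution A L μ x u := by
  obtain ⟨R, hR₁, hR₂⟩ := hμ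
  obtain ⟨⟨v, hv⟩, rfl⟩ := hL x
  obtain ⟨hw, hw'⟩ := hR₁ (A ⟨v, hv⟩ - μ • v)
  set w := R (A ⟨v, hv⟩ - μ • v)
  obtain ⟨hwA, hwL⟩ := mem_restrictKer_domain.1 hw
  rw [restrictKer_apply hw hwA] at hw'
  refine ⟨v + w, ⟨A.domain.add_mem hv hwA, ?_, ?_⟩, ?_⟩
  · have : A ⟨v + w, A.domain.add_mem hv hwA⟩ = A ⟨v, hv⟩ + A ⟨w, hwA⟩ :=
      A.map_add ⟨v, hv⟩ ⟨w, hwA⟩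
    rw [this, smul_add, ← sub_eq_zero]
    rw [← sub_eq_zero] at hw'
    rw [← neg_eq_zero, ← hw']
    abel
  · have : L ⟨v + w, A.domain.add_mem hv hwA⟩ = L ⟨v, hv⟩ + L ⟨w, hwA⟩ :=
      L.map_add ⟨v, hv⟩ ⟨w, hwA⟩
    rw [this, hwL, add_zero]
  · rintro u ⟨hu, hAu, hLu⟩
    have hd : u - v ∈ A.domain := A.domain.sub_mem hu hv
    have hdL : L ⟨u - v, hd⟩ = 0 := by
      have : L ⟨u - v, hd⟩ = L ⟨u, hu⟩ - L ⟨v, hv⟩ := L.map_sub ⟨u, hu⟩ ⟨v, hv⟩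
      rw [this, hLu, sub_self]
    have hdA : A ⟨u - v, hd⟩ = A ⟨u, hu⟩ - A ⟨v, hv⟩ := A.map_sub ⟨u, hu⟩ ⟨v, hv⟩
    have hd0 : u - v ∈ (restrictKer A L).domain := mem_restrictKer_domain.2 ⟨hd, hdL⟩
    have key := hR₂ ⟨u - v, hd0⟩
    rw [restrictKer_apply hd0 hd, hdA, hAu] at key
    have : μ • (u - v) - (μ • u - A ⟨v, hv⟩) = A ⟨v, hv⟩ - μ • v := by
      rw [smul_sub]; abel
    simp only [this] at key
    change w = u - v at key
    rw [key]; abel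

theorem dirichletOp_spec {A : X →ₗ.[ℂ] X} {L : A.domain →ₗ[ℂ] Yb}
    (hL : Function.Surjective L) {μ : ℂ} (hμ : μ ∈ resolvSet (restrictKer A L)) (x : Yb) :
    IsDirichletSolution A L μ x (dirichletOp A L μ x) :=
  Classical.epsilon_spec (existsUnique_dirichletSolution hL hμ x).exists

end Operators

/-! ### Operator matrices with coupled domain -/

/-- The data of an operator matrix with coupled domain on `X × ∂X`, with the standing
assumptions. Here `Xb` is the boundary space `∂X` and `Yb` is the space `∂Y`, continuously
embedded into `∂X` by `emb`. The boundary operator `L` only matters on `D(A)`. -/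
structure CoupledSystem (X Xb Yb : Type*) [NormedAddCommGroup X] [NormedSpace ℂ X]
    [NormedAddCommGroup Xb] [NormedSpace ℂ Xb] [NormedAddCommGroup Yb] [NormedSpace ℂ Yb] where
  emb : Yb →L[ℂ] Xb
  emb_injective : Function.Injective emb
  A : X →ₗ.[ℂ] X
  L : A.domain →ₗ[ℂ] Yb
  L_surjective : Function.Surjective L
  resolvSet_nonempty : (resolvSet (restrictKer A L)).Nonempty
  stacked_isClosed : (stacked A L).IsClosed
  D : Xb →ₗ.[ℂ] Xb
  B : Xb →ₗ.[ℂ] X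
  D_le_B : D.domain ≤ B.domain
  C : X →ₗ.[ℂ] Xb
  A_le_C : A.domain ≤ C.domain

namespace CoupledSystem

variable {X Xb Yb : Type*} [NormedAddCommGroup X] [NormedSpace ℂ X]
  [NormedAddCommGroup Xb] [NormedSpace ℂ Xb] [NormedAddCommGroup Yb] [NormedSpace ℂ Yb]

/-- `A₀`, the restriction of `A` to `ker L`. -/
def A₀ (S : CoupledSystem X Xb Yb) : X →ₗ.[ℂ] X := restrictKer S.A S.L

/-- The operator `D` with domain `D(D) ∩ ∂Y`, the lower right entry of the operator matrix with
coupled domain. It is `D` itself if `D(D) ⊆ ∂Y`. -/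
def Dpart (S : CoupledSystem X Xb Yb) : Xb →ₗ.[ℂ] Xb :=
  S.D.domRestrict (LinearMap.range (S.emb : Yb →ₗ[ℂ] Xb))

/-- The operator matrix `(u, x) ↦ (A u + B x, C u + D x)` with the coupled domain
`{(u, x) : u ∈ D(A), x ∈ D(D) ∩ ∂Y, L u = x}`. -/
def matrixOp (S : CoupledSystem X Xb Yb) : X × Xb →ₗ.[ℂ] X × Xb where
  domain :=
    { carrier := {p | p.2 ∈ S.D.domain ∧ ∃ h : p.1 ∈ S.A.domain, S.emb (S.L ⟨p.1, h⟩) = p.2}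
      add_mem' := by
        rintro p q ⟨hp, hp', hp''⟩ ⟨hq, hq', hq''⟩
        refine ⟨S.D.domain.add_mem hp hq, S.A.domain.add_mem hp' hq', ?_⟩
        rw [Prod.snd_add, ← hp'', ← hq'', ← map_add, ← map_add]
        rfl
      zero_mem' := by
        refine ⟨S.D.domain.zero_mem, S.A.domain.zero_mem, ?_⟩
        have : S.L ⟨(0 : X × Xb).1, S.A.domain.zero_mem⟩ = 0 := S.L.map_zero
        rw [this, map_zero]
        rfl
      smul_mem' := by
        rintro c p ⟨hp, hp', hp''⟩
        refine ⟨S.D.domain.smul_mem c hp, S.A.domain.smul_mem c hp', ?_⟩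
        rw [Prod.smul_snd, ← hp'', ← map_smul, ← map_smul]
        rfl }
  toFun :=
    { toFun := fun p =>
        (S.A ⟨p.1.1, p.2.2.1⟩ + S.B ⟨p.1.2, S.D_le_B p.2.1⟩,
          S.C ⟨p.1.1, S.A_le_C p.2.2.1⟩ + S.D ⟨p.1.2, p.2.1⟩)
      map_add' := by
        intro p q
        have hA := S.A.map_add ⟨p.1.1, p.2.2.1⟩ ⟨q.1.1, q.2.2.1⟩
        have hB := S.B.map_add ⟨p.1.2, S.D_le_B p.2.1⟩ ⟨q.1.2, S.D_le_B q.2.1⟩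
        have hC := S.C.map_add ⟨p.1.1, S.A_le_C p.2.2.1⟩ ⟨q.1.1, S.A_le_C q.2.2.1⟩
        have hD := S.D.map_add ⟨p.1.2, p.2.1⟩ ⟨q.1.2, q.2.1⟩
        refine Prod.ext ((congrArg₂ (· + ·) hA hB).trans ?_)
          ((congrArg₂ (· + ·) hC hD).trans ?_)
        · exact add_add_add_comm _ _ _ _
        · exact add_add_add_comm _ _ _ _
      map_smul' := by
        intro c p
        have hA := S.A.map_smul c ⟨p.1.1, p.2.2.1⟩
        have hB := S.B.map_smul c ⟨p.1.2, S.D_le_B p.2.1⟩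
        have hC := S.C.map_smul c ⟨p.1.1, S.A_le_C p.2.2.1⟩
        have hD := S.D.map_smul c ⟨p.1.2, p.2.1⟩
        refine Prod.ext ((congrArg₂ (· + ·) hA hB).trans ?_)
          ((congrArg₂ (· + ·) hC hD).trans ?_)
        · exact (smul_add _ _ _).symm
        · exact (smul_add _ _ _).symm }

/-- `A₀` is invertible, `Dbar : ∂X → X` is a bounded extension of the Dirichlet operator at
`μ = 0`, and `B - Dbar D` is bounded from `∂X` to `X`, i.e. it satisfies a norm estimate on its
domain. (A bounded extension with values in an intermediate space `W ↪ X` is in particular one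
with values in `X`.) -/
structure FeedbackBounded (S : CoupledSystem X Xb Yb) (Dbar : Xb →L[ℂ] X) : Prop where
  A₀_invertible : (0 : ℂ) ∈ resolvSet S.A₀
  extends_dirichletOp : ∀ y : Yb, Dbar (S.emb y) = dirichletOp S.A S.L 0 y
  bounded : ∃ K : ℝ, ∀ (x : Xb) (hx : x ∈ S.D.domain), x ∈ Set.range S.emb →
    ‖S.B ⟨x, S.D_le_B hx⟩ - Dbar (S.D ⟨x, hx⟩)‖ ≤ K * ‖x‖

/-- `G : ∂X → X` is a bounded extension of `B - Dbar D`, given on `D(D) ∩ ∂Y`. -/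
def IsFeedbackExtension (S : CoupledSystem X Xb Yb) (Dbar : Xb →L[ℂ] X) (G : Xb →L[ℂ] X) :
    Prop :=
  ∀ (x : Xb) (hx : x ∈ S.D.domain), x ∈ Set.range S.emb →
    G x = S.B ⟨x, S.D_le_B hx⟩ - Dbar (S.D ⟨x, hx⟩)

end CoupledSystem

section Entries

variable {X Xb : Type*} [NormedAddCommGroup X] [NormedSpace ℂ X]
  [NormedAddCommGroup Xb] [NormedSpace ℂ Xb]

/-- The convolution `t ↦ ∫₀ᵗ T₀ (t - s) G T_D (s) y ds`. -/
noncomputable def convFamily (T₀ : ℝ → X →L[ℂ] X) (G : Xb →L[ℂ] X) (TD : ℝ → Xb →L[ℂ] Xb)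
    (t : ℝ) (y : Xb) : X :=
  ∫ s in (0 : ℝ)..t, T₀ (t - s) (G (TD s y))

/-- The upper right entry of an operator family on `X × ∂X`. -/
def upperRight (T : ℝ → X × Xb →L[ℂ] X × Xb) (t : ℝ) (y : Xb) : X :=
  (T t (0, y)).1

end Entries

end CoupledMatrix

/-! The substitution `(u, x) ↦ (u - Dbar x, x)` decouples the domain. Since `A (Dbar x) = 0` and `L
(Dbar x) = x` for `x ∈ ∂Y`, the matrix becomes upper triangular on `D(A₀) × (D(D) ∩ ∂Y)`, with
diagonal `A₀`, `D` and the bounded corner `G = B - Dbar D` (`mem_matrixOp_graph_iff`). Its semigroup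
is given by the variation of constants formula with the convolution `V`; undoing the substitution
gives the family in `IsTriangular`. No perturbation theorem is needed: the cocycle identity
`convFamily_add` yields the semigroup law, and the derivative `G y` of `V` at `0` identifies the
generator (`tendsto_iff`, `generates_matrixOp`). Any other semigroup generated by the matrix agrees
with this one, because the constructed one is bounded (`eq_of_isBoundedSemigroup`).

The asymptotics rest on `V (t) = T₀ (t - s) V (s) + V (t - s) TD (s)`. As `V` is bounded and `TD`
decays, the last term is small for large `s`, uniformly in `t ≥ s`
(`exists_norm_convFamily_sub_le`). Hence orbits of `V` are, near infinity, uniform limits of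
translated orbits of `T₀`, and inherit convergence and asymptotic almost periodicity; the other
terms are orbits of `T₀` or tend to `0`. Exponential stability follows from a direct estimate. -/

namespace CoupledMatrix

/-! ### Generators: invariance, density of the domain, uniqueness of the semigroup. -/

section SemigroupTheory

variable {E F : Type*} [NormedAddCommGroup E] [NormedSpace ℂ E]
  [NormedAddCommGroup F] [NormedSpace ℂ F]

/-- Uniformly bounded, strongly convergent operators may be applied to convergent vectors. -/
theorem tendsto_apply_of_bounded {α : Type*} {l : Filter α} {U : α → E →L[ℂ] F} {z : α → E}
    {z₀ : E} {w : F} {M : ℝ} (hM : ∀ᶠ a in l, ‖U a‖ ≤ M)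
    (hU : Tendsto (fun a => U a z₀) l (𝓝 w)) (hz : Tendsto z l (𝓝 z₀)) :
    Tendsto (fun a => U a (z a)) l (𝓝 w) := by
  have h0 : Tendsto (fun a => U a (z a - z₀)) l (𝓝 0) := by
    refine squeeze_zero_norm' (a := fun a => M * ‖z a - z₀‖) ?_ ?_
    · filter_upwards [hM] with a ha
      exact (U a).le_of_opNorm_le ha _
    · have := (tendsto_iff_norm_sub_tendsto_zero.1 hz).const_mul M
      simpa using this
  have := h0.add hU
  simpa using this

namespace IsC0Semigroup

variable {T : ℝ → E →L[ℂ] E}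

/-- Nothing is known at negative times; clamping the time at `0` makes orbits continuous on all of
`ℝ`, as the integration lemmas require. -/
theorem continuous_max (hT : IsC0Semigroup T) (x : E) :
    Continuous fun t : ℝ => T (max t 0) x :=
  (hT.strongly_continuous x).comp_continuous (by fun_prop) fun t => Set.mem_Ici.2 (le_max_right t 0)

theorem apply_add (hT : IsC0Semigroup T) {s t : ℝ} (hs : 0 ≤ s) (ht : 0 ≤ t) (x : E) :
    T (s + t) x = T s (T t x) := by
  rw [hT.map_add s t hs ht]; rfl

theorem continuous_max_apply (hT : IsC0Semigroup T) (hb : IsBoundedSemigroup T)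
    {α : Type*} [TopologicalSpace α] {r : α → ℝ} {z : α → E} (hr : Continuous r)
    (hz : Continuous z) : Continuous fun a => T (max (r a) 0) (z a) := by
  obtain ⟨M, hM⟩ := hb
  refine continuous_iff_continuousAt.2 fun a₀ => ?_
  exact tendsto_apply_of_bounded (.of_forall fun a => hM _ (le_max_right _ _))
    (((hT.continuous_max (z a₀)).comp hr).tendsto a₀) (hz.tendsto a₀)

end IsC0Semigroup

theorem IsUniformlyExpStable.isBoundedSemigroup {T : ℝ → E →L[ℂ] E}
    (hT : IsUniformlyExpStable T) : IsBoundedSemigroup T := by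
  obtain ⟨M, ω, hω, h⟩ := hT
  have hM : 0 ≤ M := by simpa using (norm_nonneg _).trans (h 0 le_rfl)
  refine ⟨M, fun t ht => (h t ht).trans (mul_le_of_le_one_right hM ?_)⟩
  exact Real.exp_le_one_iff.2 (by nlinarith)

namespace Generates

variable {G : E →ₗ.[ℂ] E} {T : ℝ → E →L[ℂ] E}

/-- The graph of the generator is invariant under the semigroup. -/
theorem map_mem_graph (h : Generates G T) {x y : E} (hxy : (x, y) ∈ G.graph) {s : ℝ}
    (hs : 0 ≤ s) : (T s x, T s y) ∈ G.graph := by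
  refine (h.2 _ _).2 ?_
  refine (((T s).continuous.tendsto y).comp ((h.2 x y).1 hxy)).congr' ?_
  filter_upwards [self_mem_nhdsWithin] with t ht
  have ht' : (0 : ℝ) ≤ t := le_of_lt ht
  simp only [Function.comp_apply, map_smul, map_sub]
  rw [← h.1.apply_add hs ht', ← h.1.apply_add ht' hs, add_comm]

/-- A generator is densely defined. -/
theorem dense_domain [CompleteSpace E] (h : Generates G T) : Dense (G.domain : Set E) := by
  intro x
  set g : ℝ → E := fun r => T (max r 0) x with hg
  have hgc : Continuous g := h.1.continuous_max x
  have hg0 : g 0 = x := by simp [hg, h.1.map_zero]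
  -- The time averages `I t / t` lie in the domain and converge to `x`.
  set I : ℝ → E := fun t => ∫ r in (0 : ℝ)..t, g r with hI
  have hd : ∀ t, HasDerivAt I (g t) t := fun t => by
    exact intervalIntegral.integral_hasDerivAt_right (hgc.intervalIntegrable _ _)
      hgc.aestronglyMeasurable.stronglyMeasurableAtFilter hgc.continuousAt
  have hI0 : I 0 = 0 := by simp [hI]
  have hshift : ∀ s t : ℝ, 0 ≤ s → 0 ≤ t → T s (I t) = I (s + t) - I s := by
    intro s t hs ht
    simp only [hI]
    rw [intervalIntegral.integral_interval_sub_left (hgc.intervalIntegrable _ _)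
      (hgc.intervalIntegrable _ _), ← ContinuousLinearMap.intervalIntegral_comp_comm _
      (hgc.intervalIntegrable _ _)]
    have := intervalIntegral.integral_comp_add_left (a := 0) (b := t) g s
    rw [add_zero] at this
    rw [← this]
    refine intervalIntegral.integral_congr fun r hr => ?_
    rw [Set.uIcc_of_le ht] at hr
    simp only [hg]
    rw [max_eq_left hr.1, max_eq_left (add_nonneg hs hr.1), h.1.apply_add hs hr.1]
  have hmem : ∀ t : ℝ, 0 ≤ t → I t ∈ G.domain := by
    intro t ht
    refine LinearPMap.mem_domain_of_mem_graph ((h.2 (I t) (g t - g 0)).2 ?_)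
    refine ((hd t).tendsto_slope_zero_right.sub (hd 0).tendsto_slope_zero_right).congr' ?_
    filter_upwards [self_mem_nhdsWithin] with s hs
    rw [hshift s t (le_of_lt hs) ht, zero_add, hI0, Complex.coe_smul, ← smul_sub, add_comm s t]
    congr 1
    abel
  have hlim : Tendsto (fun t : ℝ => t⁻¹ • I t) (𝓝[>] 0) (𝓝 x) := by
    have := (hd 0).tendsto_slope_zero_right
    simpa [hI0, hg0] using this
  refine mem_closure_of_tendsto hlim ?_
  filter_upwards [self_mem_nhdsWithin] with t ht
  rw [← Complex.coe_smul]
  exact G.domain.smul_mem _ (hmem t (le_of_lt ht))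

/-- A bounded semigroup is determined by its generator. -/
theorem eq_of_isBoundedSemigroup [CompleteSpace E] {T' : ℝ → E →L[ℂ] E} (h : Generates G T)
    (hb : IsBoundedSemigroup T) (h' : Generates G T') {t : ℝ} (ht : 0 ≤ t) : T t = T' t := by
  refine ContinuousLinearMap.ext_on (s := (G.domain : Set E)) (by
    rw [Submodule.span_eq]; exact h.dense_domain) fun x hx => ?_
  obtain ⟨M, hM⟩ := id hb
  -- This interpolates between `T t x` at `s = 0` and `T' t x` at `s = t`; a vanishing right
  -- derivative makes it constant.
  set f : ℝ → E := fun s => T (max (t - s) 0) (T' (max s 0) x) with hf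
  have hfc : Continuous f :=
    h.1.continuous_max_apply hb (by fun_prop) (h'.1.continuous_max x)
  have hderiv : ∀ s ∈ Set.Ico 0 t, HasDerivWithinAt f 0 (Set.Ici s) s := by
    intro s hs
    rw [hasDerivWithinAt_iff_tendsto_slope, Set.Ici_sdiff_left]
    have hz := h'.map_mem_graph (G.mem_graph ⟨x, hx⟩) hs.1
    set z := T' s x
    have hsub : Tendsto (fun r : ℝ => r - s) (𝓝[>] s) (𝓝[>] 0) := by
      refine tendsto_nhdsWithin_iff.2 ⟨?_, ?_⟩
      · have : Tendsto (fun r : ℝ => r - s) (𝓝 s) (𝓝 (s - s)) :=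
          (continuous_id.sub continuous_const).tendsto s
        rw [sub_self] at this
        exact this.mono_left nhdsWithin_le_nhds
      · filter_upwards [self_mem_nhdsWithin] with r hr
        exact sub_pos.2 (Set.mem_Ioi.1 hr)
    -- The orbit point `z` stays in the common domain, so both difference quotients tend to the same
    -- generator value and cancel. The outer operator still varies with `r`, which is where
    -- boundedness of `T` enters.
    have hq := (((h'.2 _ _).1 hz).comp hsub).sub (((h.2 _ _).1 hz).comp hsub)
    rw [sub_self] at hq
    have := tendsto_apply_of_bounded (U := fun r : ℝ => T (max (t - r) 0)) (w := 0)
      (.of_forall fun r => hM _ (le_max_right _ _)) (by simp) hq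
    refine this.congr' ?_
    filter_upwards [Ioo_mem_nhdsGT hs.2] with r hr
    have hrs : 0 ≤ r - s := sub_nonneg.2 hr.1.le
    have htr : 0 ≤ t - r := sub_nonneg.2 hr.2.le
    have e1 : T' r x = T' (r - s) z := by
      rw [← h'.1.apply_add hrs hs.1, sub_add_cancel]
    have e2 : T (t - s) z = T (t - r) (T (r - s) z) := by
      rw [← h.1.apply_add htr hrs, sub_add_sub_cancel]
    simp only [Function.comp_apply, slope, vsub_eq_sub, hf]
    rw [max_eq_left htr, max_eq_left (sub_nonneg.2 hs.2.le), max_eq_left hs.1,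
      max_eq_left (hs.1.trans hr.1.le), e1, e2, ← smul_sub, map_smul,
      Complex.coe_smul, sub_sub_sub_cancel_right, map_sub]
  have := constant_of_has_deriv_right_zero hfc.continuousOn hderiv t ⟨ht, le_rfl⟩
  simp only [hf, sub_self, max_self, sub_zero, max_eq_left ht, h.1.map_zero, h'.1.map_zero] at this
  exact this.symm

end Generates

end SemigroupTheory

/-! ### The convolution: continuity, cocycle identity, derivative at zero, bounds. -/

section Convolution

variable {X Xb : Type*} [NormedAddCommGroup X] [NormedSpace ℂ X]
  [NormedAddCommGroup Xb] [NormedSpace ℂ Xb]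
  {T₀ : ℝ → X →L[ℂ] X} {G : Xb →L[ℂ] X} {TD : ℝ → Xb →L[ℂ] Xb}

/-- The integrand of `convFamily`, with the times clamped to `[0, ∞)`. -/
def convKernel (T₀ : ℝ → X →L[ℂ] X) (G : Xb →L[ℂ] X) (TD : ℝ → Xb →L[ℂ] Xb) (y : Xb)
    (t s : ℝ) : X :=
  T₀ (max (t - s) 0) (G (TD (max s 0) y))

theorem convKernel_eq {t s : ℝ} (hs : 0 ≤ s) (hst : s ≤ t) (y : Xb) :
    convKernel T₀ G TD y t s = T₀ (t - s) (G (TD s y)) := by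
  rw [convKernel, max_eq_left hs, max_eq_left (sub_nonneg.2 hst)]

theorem convFamily_eq_integral_convKernel {t : ℝ} (ht : 0 ≤ t) (y : Xb) :
    convFamily T₀ G TD t y = ∫ s in (0 : ℝ)..t, convKernel T₀ G TD y t s := by
  refine intervalIntegral.integral_congr fun s hs => ?_
  rw [Set.uIcc_of_le ht] at hs
  exact (convKernel_eq hs.1 hs.2 y).symm

theorem convFamily_zero_left (y : Xb) : convFamily T₀ G TD 0 y = 0 := by
  simp [convFamily]

theorem continuous_convKernel (hT₀ : IsC0Semigroup T₀) (hb : IsBoundedSemigroup T₀)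
    (hTD : IsC0Semigroup TD) (y : Xb) :
    Continuous (Function.uncurry (convKernel T₀ G TD y)) := by
  have h1 : Continuous fun p : ℝ × ℝ => G (TD (max p.2 0) y) :=
    G.continuous.comp ((hTD.continuous_max y).comp continuous_snd)
  exact hT₀.continuous_max_apply hb (r := fun p : ℝ × ℝ => p.1 - p.2) (by fun_prop) h1

theorem intervalIntegrable_convKernel (hT₀ : IsC0Semigroup T₀) (hb : IsBoundedSemigroup T₀)
    (hTD : IsC0Semigroup TD) (y : Xb) (t a b : ℝ) :
    IntervalIntegrable (convKernel T₀ G TD y t) MeasureTheory.volume a b :=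
  ((continuous_convKernel hT₀ hb hTD y).comp
    (continuous_const.prodMk continuous_id)).intervalIntegrable _ _

theorem continuousOn_convFamily (hT₀ : IsC0Semigroup T₀) (hb : IsBoundedSemigroup T₀)
    (hTD : IsC0Semigroup TD) (y : Xb) :
    ContinuousOn (fun t => convFamily T₀ G TD t y) (Set.Ici 0) :=
  (intervalIntegral.continuous_parametric_intervalIntegral_of_continuous
    (continuous_convKernel hT₀ hb hTD y) continuous_id).continuousOn.congr
    fun _ ht => convFamily_eq_integral_convKernel ht y

theorem convFamily_add_right (hT₀ : IsC0Semigroup T₀) (hb : IsBoundedSemigroup T₀)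
    (hTD : IsC0Semigroup TD) {t : ℝ} (ht : 0 ≤ t) (x y : Xb) :
    convFamily T₀ G TD t (x + y) = convFamily T₀ G TD t x + convFamily T₀ G TD t y := by
  simp only [convFamily_eq_integral_convKernel ht]
  rw [← intervalIntegral.integral_add (intervalIntegrable_convKernel hT₀ hb hTD _ _ _ _)
    (intervalIntegrable_convKernel hT₀ hb hTD _ _ _ _)]
  simp [convKernel]

theorem convFamily_smul (c : ℂ) (t : ℝ) (y : Xb) :
    convFamily T₀ G TD t (c • y) = c • convFamily T₀ G TD t y := by
  simp [convFamily, intervalIntegral.integral_smul]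

/-- The cocycle identity of the convolution. -/
theorem convFamily_add (hT₀ : IsC0Semigroup T₀) (hb : IsBoundedSemigroup T₀)
    (hTD : IsC0Semigroup TD) {t s : ℝ} (ht : 0 ≤ t) (hs : 0 ≤ s) (y : Xb) [CompleteSpace X] :
    convFamily T₀ G TD (t + s) y =
      T₀ t (convFamily T₀ G TD s y) + convFamily T₀ G TD t (TD s y) := by
  have hint := intervalIntegrable_convKernel (G := G) hT₀ hb hTD y
  -- The integral is split at `s`: on `[0, s]` the operator `T₀ t` factors out, on `[s, t + s]` a
  -- shift by `s` turns the orbit of `y` into that of `TD s y`.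
  rw [convFamily_eq_integral_convKernel (add_nonneg ht hs),
    ← intervalIntegral.integral_add_adjacent_intervals (hint _ 0 s) (hint _ s (t + s))]
  congr 1
  · rw [convFamily_eq_integral_convKernel hs,
      ← ContinuousLinearMap.intervalIntegral_comp_comm _ (hint _ _ _)]
    refine intervalIntegral.integral_congr fun r hr => ?_
    rw [Set.uIcc_of_le hs] at hr
    rw [convKernel_eq hr.1 (by linarith [hr.2]), convKernel_eq hr.1 hr.2,
      ← hT₀.apply_add ht (sub_nonneg.2 hr.2), add_sub_assoc]
  · have h := intervalIntegral.integral_comp_add_right (a := 0) (b := t)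
      (convKernel T₀ G TD y (t + s)) s
    rw [zero_add] at h
    rw [← h, convFamily]
    refine intervalIntegral.integral_congr fun r hr => ?_
    rw [Set.uIcc_of_le ht] at hr
    rw [convKernel_eq (add_nonneg hr.1 hs) (by linarith [hr.2]), add_sub_add_right_eq_sub,
      hTD.apply_add hr.1 hs]

/-- The convolution has derivative `G y` at time `0`. -/
theorem tendsto_convFamily_div (hT₀ : IsC0Semigroup T₀) (hb : IsBoundedSemigroup T₀)
    (hTD : IsC0Semigroup TD) (y : Xb) [CompleteSpace X] :
    Tendsto (fun t : ℝ => ((t⁻¹ : ℝ) : ℂ) • convFamily T₀ G TD t y) (𝓝[>] 0) (𝓝 (G y)) := by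
  -- Rescaling to the fixed interval `[0, 1]` turns the quotient into a parameter integral
  -- continuous at `t = 0`.
  set Φ : ℝ → X := fun t => ∫ r in (0 : ℝ)..1, convKernel T₀ G TD y t (t * r) with hΦ
  have hΦc : Continuous Φ := by
    refine intervalIntegral.continuous_parametric_intervalIntegral_of_continuous' ?_ 0 1
    exact (continuous_convKernel hT₀ hb hTD y).comp
      (f := fun p : ℝ × ℝ => (p.1, p.1 * p.2)) (by fun_prop)
  have hΦ0 : Φ 0 = G y := by
    simp [hΦ, convKernel, hT₀.map_zero, hTD.map_zero]
  rw [← hΦ0]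
  refine ((hΦc.tendsto 0).mono_left nhdsWithin_le_nhds).congr' ?_
  filter_upwards [self_mem_nhdsWithin] with t ht
  have ht : 0 < t := ht
  have h := intervalIntegral.smul_integral_comp_mul_left (a := 0) (b := 1)
    (convKernel T₀ G TD y t) t
  rw [mul_zero, mul_one] at h
  rw [convFamily_eq_integral_convKernel ht.le, ← h, Complex.coe_smul, inv_smul_smul₀ ht.ne']

theorem norm_convFamily_le {M N ω : ℝ} (hM : ∀ t : ℝ, 0 ≤ t → ‖T₀ t‖ ≤ M) (hω : 0 < ω)
    (hN : ∀ t : ℝ, 0 ≤ t → ‖TD t‖ ≤ N * Real.exp (-ω * t)) {t : ℝ} (ht : 0 ≤ t) (y : Xb) :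
    ‖convFamily T₀ G TD t y‖ ≤ M * ‖G‖ * N * ω⁻¹ * ‖y‖ := by
  have hM0 : 0 ≤ M := (norm_nonneg _).trans (hM 0 le_rfl)
  have hN0 : 0 ≤ N := by simpa using (norm_nonneg _).trans (hN 0 le_rfl)
  have hbound : ‖convFamily T₀ G TD t y‖ ≤
      ∫ s in (0 : ℝ)..t, M * ‖G‖ * N * ‖y‖ * Real.exp (-ω * s) := by
    refine intervalIntegral.norm_integral_le_of_norm_le ht ?_
      (Continuous.intervalIntegrable (by fun_prop) _ _)
    refine .of_forall fun s hs => ?_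
    calc ‖T₀ (t - s) (G (TD s y))‖ ≤ M * (‖G‖ * (N * Real.exp (-ω * s) * ‖y‖)) := by
          refine (T₀ (t - s)).le_of_opNorm_le_of_le (hM _ (sub_nonneg.2 hs.2)) ?_
          refine G.le_of_opNorm_le_of_le le_rfl ?_
          exact (TD s).le_of_opNorm_le (hN _ hs.1.le) _
      _ = _ := by ring
  refine hbound.trans ?_
  rw [intervalIntegral.integral_const_mul,
    intervalIntegral.integral_comp_mul_left _ (neg_ne_zero.2 hω.ne'), integral_exp, mul_zero,
    Real.exp_zero, smul_eq_mul, inv_neg, neg_mul, ← mul_neg, neg_sub]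
  calc M * ‖G‖ * N * ‖y‖ * (ω⁻¹ * (1 - Real.exp (-ω * t)))
      ≤ M * ‖G‖ * N * ‖y‖ * (ω⁻¹ * 1) := by
        gcongr
        exact sub_le_self _ (Real.exp_pos _).le
    _ = _ := by ring

/-- With equal rates the exponentials multiply to `exp (-a t)`, independent of `s`, so integration
costs a factor `t`. Half the rate is given up to absorb it. -/
theorem norm_convFamily_le_exp {M N a : ℝ} (ha : 0 < a)
    (hM : ∀ t : ℝ, 0 ≤ t → ‖T₀ t‖ ≤ M * Real.exp (-a * t))
    (hN : ∀ t : ℝ, 0 ≤ t → ‖TD t‖ ≤ N * Real.exp (-a * t)) {t : ℝ} (ht : 0 ≤ t) (y : Xb) :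
    ‖convFamily T₀ G TD t y‖ ≤ M * ‖G‖ * N * (2 / a) * Real.exp (-(a / 2) * t) * ‖y‖ := by
  have hM0 : 0 ≤ M := by simpa using (norm_nonneg _).trans (hM 0 le_rfl)
  have hN0 : 0 ≤ N := by simpa using (norm_nonneg _).trans (hN 0 le_rfl)
  have hbound : ‖convFamily T₀ G TD t y‖ ≤
      (M * ‖G‖ * N * Real.exp (-a * t) * ‖y‖) * |t - 0| := by
    refine intervalIntegral.norm_integral_le_of_norm_le_const fun s hs => ?_
    rw [Set.uIoc_of_le ht] at hs
    calc ‖T₀ (t - s) (G (TD s y))‖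
        ≤ M * Real.exp (-a * (t - s)) * (‖G‖ * (N * Real.exp (-a * s) * ‖y‖)) := by
          refine (T₀ (t - s)).le_of_opNorm_le_of_le (hM _ (sub_nonneg.2 hs.2)) ?_
          refine G.le_of_opNorm_le_of_le le_rfl ?_
          exact (TD s).le_of_opNorm_le (hN _ hs.1.le) _
      _ = M * ‖G‖ * N * (Real.exp (-a * (t - s)) * Real.exp (-a * s)) * ‖y‖ := by ring
      _ = _ := by rw [← Real.exp_add]; ring_nf
  have hexp : t * Real.exp (-a * t) ≤ 2 / a * Real.exp (-(a / 2) * t) := by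
    have h1 : t ≤ 2 / a * Real.exp (a / 2 * t) := by
      have := Real.add_one_le_exp (a / 2 * t)
      calc t = 2 / a * (a / 2 * t) := by field_simp
        _ ≤ _ := by gcongr; linarith
    calc t * Real.exp (-a * t) ≤ 2 / a * Real.exp (a / 2 * t) * Real.exp (-a * t) := by gcongr
      _ = _ := by rw [mul_assoc, ← Real.exp_add]; ring_nf
  rw [sub_zero, abs_of_nonneg ht] at hbound
  calc _ ≤ _ := hbound
    _ = M * ‖G‖ * N * ‖y‖ * (t * Real.exp (-a * t)) := by ring
    _ ≤ M * ‖G‖ * N * ‖y‖ * (2 / a * Real.exp (-(a / 2) * t)) := by gcongr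
    _ = _ := by ring

/-- For large `s`, the convolution is uniformly close to `t ↦ T₀ (t - s) (V s y)`. -/
theorem exists_norm_convFamily_sub_le (hT₀ : IsC0Semigroup T₀) (hb : IsBoundedSemigroup T₀)
    (hTD : IsC0Semigroup TD) (hstable : IsUniformlyExpStable TD) (y : Xb) [CompleteSpace X]
    {ε : ℝ} (hε : 0 < ε) :
    ∃ s : ℝ, 0 ≤ s ∧ ∀ t, s ≤ t →
      ‖convFamily T₀ G TD t y - T₀ (t - s) (convFamily T₀ G TD s y)‖ ≤ ε := by
  obtain ⟨M, hM⟩ := id hb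
  obtain ⟨N, ω, hω, hN⟩ := id hstable
  -- `K` bounds the convolution at all times `t ≥ 0`, which makes the choice of `s` independent of
  -- `t`.
  set K := M * ‖G‖ * N * ω⁻¹
  have hlim : Tendsto (fun s : ℝ => K * (N * Real.exp (-ω * s) * ‖y‖)) atTop (𝓝 0) := by
    have h1 : Tendsto (fun s : ℝ => Real.exp (-ω * s)) atTop (𝓝 0) :=
      Real.tendsto_exp_atBot.comp (tendsto_id.const_mul_atTop_of_neg (neg_lt_zero.2 hω))
    simpa using ((h1.const_mul N).mul_const ‖y‖).const_mul K
  have hK : 0 ≤ K := by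
    have hM0 : 0 ≤ M := (norm_nonneg _).trans (hM 0 le_rfl)
    have hN0 : 0 ≤ N := by simpa using (norm_nonneg _).trans (hN 0 le_rfl)
    positivity
  obtain ⟨s, hs, hs0⟩ := ((hlim.eventually_le_const hε).and (eventually_ge_atTop 0)).exists
  refine ⟨s, hs0, fun t hst => ?_⟩
  have hts := sub_nonneg.2 hst
  have := convFamily_add (G := G) hT₀ hb hTD hts hs0 y
  rw [sub_add_cancel] at this
  rw [this, add_sub_cancel_left]
  refine (norm_convFamily_le hM hω hN hts _).trans (le_trans ?_ hs)
  gcongr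
  exact (TD s).le_of_opNorm_le (hN _ hs0) _

end Convolution

/-! ### Trigonometric polynomials and asymptotic almost periodicity. -/

section AlmostPeriodicity

variable {E F : Type*} [NormedAddCommGroup E] [NormedSpace ℂ E]
  [NormedAddCommGroup F] [NormedSpace ℂ F]

theorem continuous_of_mem_trigPolynomials {p : ℝ → E} (hp : p ∈ trigPolynomials E) :
    Continuous p := by
  induction hp using Submodule.span_induction with
  | mem f hf => obtain ⟨η, x, rfl⟩ := hf; fun_prop
  | zero => exact continuous_const
  | add f g _ _ hf hg => exact hf.add hg
  | smul c f _ hf => exact hf.const_smul c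

/-- Finitely many characters of `ℝ` are simultaneously close to `1` at arbitrarily large times. -/
theorem exists_large_norm_exp_sub_one_lt (s : Finset ℝ) {δ : ℝ} (hδ : 0 < δ) (T : ℝ) :
    ∃ τ : ℝ, T ≤ τ ∧ ∀ η ∈ s, ‖Complex.exp (Complex.I * η * τ) - 1‖ < δ := by
  have hnorm : ∀ η τ : ℝ, ‖Complex.exp (Complex.I * η * τ)‖ = 1 := fun η τ => by
    rw [mul_assoc, ← Complex.ofReal_mul, mul_comm, Complex.norm_exp_ofReal_mul_I]
  -- Compactness gives a convergent subsequence of these points. Differences of its late times are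
  -- common approximate periods, since the characters are multiplicative of modulus one.
  set u : ℕ → s → ℂ := fun n η => Complex.exp (Complex.I * (η : ℝ) * (n : ℝ))
  have hu : ∀ n, u n ∈ Metric.closedBall (0 : s → ℂ) 1 := fun n => by
    rw [mem_closedBall_zero_iff, pi_norm_le_iff_of_nonneg zero_le_one]
    exact fun η => (hnorm η n).le
  obtain ⟨a, -, φ, hφ, hlim⟩ := tendsto_subseq_of_bounded Metric.isBounded_closedBall hu
  obtain ⟨N, hN⟩ := Metric.cauchySeq_iff'.1 hlim.cauchySeq δ hδ
  obtain ⟨k, hk⟩ := exists_nat_ge (T + φ N)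
  -- The index `N` gives closeness; `k` makes the difference of times at least `T`, as `φ n ≥ n`.
  set n := max k N
  refine ⟨(φ n : ℝ) - φ N, ?_, fun η hη => ?_⟩
  · have h1 : (k : ℝ) ≤ φ n := by exact_mod_cast (le_max_left k N).trans (hφ.id_le n)
    linarith
  · have h1 := (dist_le_pi_dist (u (φ n)) (u (φ N)) ⟨η, hη⟩).trans_lt (hN n (le_max_right _ _))
    have h2 : Complex.exp (Complex.I * η * (φ n : ℝ)) =
        Complex.exp (Complex.I * η * (φ N : ℝ)) *
          Complex.exp (Complex.I * η * ((φ n : ℝ) - φ N : ℝ)) := by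
      rw [← Complex.exp_add]
      push_cast
      ring_nf
    have h3 : u (φ n) ⟨η, hη⟩ - u (φ N) ⟨η, hη⟩ = Complex.exp (Complex.I * η * (φ N : ℝ)) *
        (Complex.exp (Complex.I * η * ((φ n : ℝ) - φ N : ℝ)) - 1) := by
      rw [mul_sub, mul_one, ← h2]
    rwa [dist_eq_norm, h3, norm_mul, hnorm, one_mul] at h1

/-- Common approximate periods of finitely many characters are approximate periods of a
trigonometric polynomial. -/
theorem exists_finset_norm_translate_sub_le {p : ℝ → E} (hp : p ∈ trigPolynomials E) :
    ∀ ε : ℝ, 0 < ε → ∃ (s : Finset ℝ) (δ : ℝ), 0 < δ ∧ ∀ τ : ℝ,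
      (∀ η ∈ s, ‖Complex.exp (Complex.I * η * τ) - 1‖ < δ) → ∀ t, ‖p (t + τ) - p t‖ ≤ ε := by
  classical
  induction hp using Submodule.span_induction with
  | mem f hf =>
    obtain ⟨η, x, rfl⟩ := hf
    intro ε hε
    refine ⟨{η}, ε / (‖x‖ + 1), by positivity, fun τ hτ t => ?_⟩
    have h1 := (hτ η (Finset.mem_singleton_self η)).le
    have h2 : Complex.exp (Complex.I * η * (t + τ : ℝ)) • x - Complex.exp (Complex.I * η * t) • x =
        (Complex.exp (Complex.I * η * t) * (Complex.exp (Complex.I * η * τ) - 1)) • x := by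
      rw [← sub_smul, mul_sub, mul_one, ← Complex.exp_add]
      push_cast
      ring_nf
    have h3 : ‖Complex.exp (Complex.I * η * t)‖ = 1 := by
      rw [mul_assoc, ← Complex.ofReal_mul, mul_comm, Complex.norm_exp_ofReal_mul_I]
    calc _ = ‖Complex.exp (Complex.I * η * τ) - 1‖ * ‖x‖ := by
          rw [h2, norm_smul, norm_mul, h3, one_mul]
      _ ≤ ε / (‖x‖ + 1) * (‖x‖ + 1) := by gcongr; linarith
      _ = ε := by field_simp
  | zero => exact fun ε hε => ⟨∅, 1, one_pos, fun τ _ t => by simpa using hε.le⟩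
  | add f g _ _ hf hg =>
    intro ε hε
    obtain ⟨s, δ, hδ, h⟩ := hf (ε / 2) (half_pos hε)
    obtain ⟨s', δ', hδ', h'⟩ := hg (ε / 2) (half_pos hε)
    refine ⟨s ∪ s', min δ δ', lt_min hδ hδ', fun τ hτ t => ?_⟩
    have h1 := h τ (fun η hη =>
      (hτ η (Finset.mem_union_left _ hη)).trans_le (min_le_left _ _)) t
    have h2 := h' τ (fun η hη =>
      (hτ η (Finset.mem_union_right _ hη)).trans_le (min_le_right _ _)) t
    calc ‖(f + g) (t + τ) - (f + g) t‖ = ‖(f (t + τ) - f t) + (g (t + τ) - g t)‖ := by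
          rw [Pi.add_apply, Pi.add_apply, add_sub_add_comm]
      _ ≤ ε := (norm_add_le _ _).trans (by linarith)
  | smul c f _ hf =>
    intro ε hε
    obtain ⟨s, δ, hδ, h⟩ := hf (ε / (‖c‖ + 1)) (by positivity)
    refine ⟨s, δ, hδ, fun τ hτ t => ?_⟩
    calc ‖(c • f) (t + τ) - (c • f) t‖ = ‖c‖ * ‖f (t + τ) - f t‖ := by
          rw [Pi.smul_apply, Pi.smul_apply, ← smul_sub, norm_smul]
      _ ≤ (‖c‖ + 1) * (ε / (‖c‖ + 1)) := by
          gcongr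
          · linarith
          · exact h τ hτ t
      _ = ε := by field_simp

/-- A bound near infinity of a trigonometric polynomial holds everywhere. -/
theorem norm_le_of_eventually_of_mem_trigPolynomials {p : ℝ → E} (hp : p ∈ trigPolynomials E)
    {c : ℝ} (h : ∀ᶠ t in atTop, ‖p t‖ ≤ c) (t : ℝ) : ‖p t‖ ≤ c := by
  obtain ⟨T, hT⟩ := eventually_atTop.1 h
  refine le_of_forall_pos_le_add fun ε hε => ?_
  obtain ⟨s, δ, hδ, hs⟩ := exists_finset_norm_translate_sub_le hp ε hε
  obtain ⟨τ, hτT, hτ⟩ := exists_large_norm_exp_sub_one_lt s hδ (T - t)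
  calc ‖p t‖ = ‖p (t + τ) - (p (t + τ) - p t)‖ := by rw [sub_sub_cancel]
    _ ≤ ‖p (t + τ)‖ + ‖p (t + τ) - p t‖ := norm_sub_le _ _
    _ ≤ c + ε := add_le_add (hT _ (by linarith)) (hs τ hτ t)

/-- `f` is approximated near infinity by trigonometric polynomials. -/
def IsEventuallyApproxTrig (f : ℝ → E) : Prop :=
  ∀ ε : ℝ, 0 < ε → ∃ p ∈ trigPolynomials E, ∀ᶠ t in atTop, ‖f t - p t‖ ≤ ε

theorem IsAsymptoticallyAlmostPeriodic.isEventuallyApproxTrig {f : ℝ → E}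
    (hf : IsAsymptoticallyAlmostPeriodic f) : IsEventuallyApproxTrig f := by
  intro ε hε
  obtain ⟨g, h, hg, -, hh, hfgh⟩ := hf
  obtain ⟨p, hp, hgp⟩ := hg (ε / 2) (half_pos hε)
  refine ⟨p, hp, ?_⟩
  have h0 : ∀ᶠ t in atTop, ‖h t‖ < ε / 2 := by
    simpa using hh.norm.eventually_lt_const (by simpa using half_pos hε)
  filter_upwards [h0, eventually_ge_atTop 0] with t ht ht0
  calc ‖f t - p t‖ = ‖(g t - p t) + h t‖ := by rw [hfgh t ht0]; congr 1; abel
    _ ≤ ε := (norm_add_le _ _).trans (by linarith [hgp t ht0])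

namespace IsEventuallyApproxTrig

theorem add {f g : ℝ → E} (hf : IsEventuallyApproxTrig f) (hg : IsEventuallyApproxTrig g) :
    IsEventuallyApproxTrig (fun t => f t + g t) := by
  intro ε hε
  obtain ⟨p, hp, hfp⟩ := hf (ε / 2) (half_pos hε)
  obtain ⟨q, hq, hgq⟩ := hg (ε / 2) (half_pos hε)
  refine ⟨p + q, Submodule.add_mem _ hp hq, ?_⟩
  filter_upwards [hfp, hgq] with t h1 h2
  rw [Pi.add_apply, add_sub_add_comm]
  exact (norm_add_le _ _).trans (by linarith)

theorem clm_comp {f : ℝ → E} (hf : IsEventuallyApproxTrig f) (Λ : E →L[ℂ] F) :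
    IsEventuallyApproxTrig (fun t => Λ (f t)) := by
  have hmap : ∀ p ∈ trigPolynomials E, (fun t => Λ (p t)) ∈ trigPolynomials F := by
    intro p hp
    induction hp using Submodule.span_induction with
    | mem f hf =>
      obtain ⟨η, x, rfl⟩ := hf
      exact Submodule.subset_span ⟨η, Λ x, by simp⟩
    | zero => simp only [Pi.zero_apply, map_zero]; exact Submodule.zero_mem _
    | add f g _ _ hf hg => simpa using! Submodule.add_mem _ hf hg
    | smul c f _ hf => simpa using! Submodule.smul_mem _ c hf
  intro ε hε
  obtain ⟨p, hp, hfp⟩ := hf (ε / (‖Λ‖ + 1)) (by positivity)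
  refine ⟨_, hmap p hp, ?_⟩
  filter_upwards [hfp] with t ht
  calc ‖Λ (f t) - Λ (p t)‖ = ‖Λ (f t - p t)‖ := by rw [map_sub]
    _ ≤ (‖Λ‖ + 1) * (ε / (‖Λ‖ + 1)) := Λ.le_of_opNorm_le_of_le (by linarith) ht
    _ = ε := by field_simp

theorem of_tendsto_zero {f : ℝ → E} (hf : Tendsto f atTop (𝓝 0)) : IsEventuallyApproxTrig f := by
  intro ε hε
  refine ⟨0, Submodule.zero_mem _, ?_⟩
  filter_upwards [hf.norm.eventually_lt_const (by simpa using hε)] with t ht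
  simpa using ht.le

theorem comp_sub {f : ℝ → E} (hf : IsEventuallyApproxTrig f) (s : ℝ) :
    IsEventuallyApproxTrig (fun t => f (t - s)) := by
  have hmap : ∀ p ∈ trigPolynomials E, (fun t => p (t - s)) ∈ trigPolynomials E := by
    intro p hp
    induction hp using Submodule.span_induction with
    | mem f hf =>
      obtain ⟨η, x, rfl⟩ := hf
      refine Submodule.subset_span ⟨η, Complex.exp (-(Complex.I * η * s)) • x, ?_⟩
      funext t
      rw [smul_smul, ← Complex.exp_add]
      push_cast
      ring_nf
    | zero => exact Submodule.zero_mem _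
    | add f g _ _ hf hg => exact Submodule.add_mem _ hf hg
    | smul c f _ hf => exact Submodule.smul_mem _ c hf
  intro ε hε
  obtain ⟨p, hp, hfp⟩ := hf ε hε
  exact ⟨_, hmap p hp, (tendsto_atTop_add_const_right atTop (-s) tendsto_id).eventually hfp⟩

/-- Closure under uniform approximation near infinity is the reason for working with this notion: no
decomposition of the approximants has to be tracked. -/
theorem of_forall_approx {f : ℝ → E} (hf : ∀ ε : ℝ, 0 < ε → ∃ g : ℝ → E,
    IsEventuallyApproxTrig g ∧ ∀ᶠ t in atTop, ‖f t - g t‖ ≤ ε) : IsEventuallyApproxTrig f := by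
  intro ε hε
  obtain ⟨g, hg, hfg⟩ := hf (ε / 2) (half_pos hε)
  obtain ⟨p, hp, hgp⟩ := hg (ε / 2) (half_pos hε)
  refine ⟨p, hp, ?_⟩
  filter_upwards [hfg, hgp] with t h1 h2
  exact (norm_sub_le_norm_sub_add_norm_sub _ (g t) _).trans (by linarith)

theorem congr' {f g : ℝ → E} (hf : IsEventuallyApproxTrig f) (hfg : f =ᶠ[atTop] g) :
    IsEventuallyApproxTrig g :=
  of_forall_approx fun ε hε => ⟨f, hf, hfg.mono fun t ht => by simpa [ht] using hε.le⟩

/-- Continuous functions approximated near infinity by trigonometric polynomials are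
asymptotically almost periodic. -/
theorem isAsymptoticallyAlmostPeriodic [CompleteSpace E] {f : ℝ → E}
    (hf : IsEventuallyApproxTrig f) (hc : ContinuousOn f (Set.Ici 0)) :
    IsAsymptoticallyAlmostPeriodic f := by
  set e : ℕ → ℝ := fun n => 1 / ((n : ℝ) + 1)
  have he : ∀ n, 0 < e n := fun n => Nat.one_div_pos_of_nat
  have he0 : Tendsto e atTop (𝓝 0) := tendsto_one_div_add_atTop_nhds_zero_nat
  choose p hp hfp using fun n => hf (e n) (he n)
  -- The approximants are compared through `f` only near infinity; recurrence of trigonometric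
  -- polynomials extends the bound to all `t`. Thus they converge uniformly on `ℝ`, and the limit
  -- `g` is the almost periodic part.
  have hpp : ∀ m n t, ‖p m t - p n t‖ ≤ e m + e n := fun m n t => by
    refine norm_le_of_eventually_of_mem_trigPolynomials (Submodule.sub_mem _ (hp m) (hp n)) ?_ t
    filter_upwards [hfp m, hfp n] with r h1 h2
    rw [Pi.sub_apply]
    refine (norm_sub_le_norm_sub_add_norm_sub _ (f r) _).trans ?_
    rw [norm_sub_rev]
    exact add_le_add h1 h2
  have hcau : ∀ t, CauchySeq fun n => p n t := fun t => by
    refine Metric.cauchySeq_iff.2 fun ε hε => ?_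
    obtain ⟨N, hN⟩ := eventually_atTop.1 (he0.eventually_lt_const (half_pos hε))
    refine ⟨N, fun m hm n hn => ?_⟩
    rw [dist_eq_norm]
    exact (hpp m n t).trans_lt (by linarith [hN m hm, hN n hn])
  choose g hg using fun t => cauchySeq_tendsto_of_complete (hcau t)
  have hgp : ∀ n t, ‖g t - p n t‖ ≤ e n := fun n t => by
    have h1 : Tendsto (fun m => ‖p m t - p n t‖) atTop (𝓝 ‖g t - p n t‖) :=
      ((hg t).sub_const _).norm
    have h2 : Tendsto (fun m => e m + e n) atTop (𝓝 (0 + e n)) := he0.add_const _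
    rw [zero_add] at h2
    exact le_of_tendsto_of_tendsto' h1 h2 fun m => hpp m n t
  have hgc : Continuous g := by
    have hu : TendstoUniformly p g atTop := by
      refine Metric.tendstoUniformly_iff.2 fun ε hε => ?_
      filter_upwards [he0.eventually_lt_const hε] with n hn t
      rw [dist_eq_norm]
      exact (hgp n t).trans_lt hn
    exact hu.continuous (.of_forall fun n => continuous_of_mem_trigPolynomials (hp n))
  refine ⟨g, fun t => f t - g t, fun ε hε => ?_, hc.sub hgc.continuousOn, ?_,
    fun t _ => (add_sub_cancel _ _).symm⟩
  · obtain ⟨n, hn⟩ := (he0.eventually_lt_const hε).exists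
    exact ⟨p n, hp n, fun t _ => (hgp n t).trans hn.le⟩
  · rw [Metric.tendsto_nhds]
    intro ε hε
    obtain ⟨n, hn⟩ := (he0.eventually_lt_const (half_pos hε)).exists
    filter_upwards [hfp n] with t ht
    rw [dist_zero_right]
    refine (norm_sub_le_norm_sub_add_norm_sub _ (p n t) _).trans_lt ?_
    rw [norm_sub_rev (p n t)]
    linarith [hgp n t]

end IsEventuallyApproxTrig

end AlmostPeriodicity

/-! ### Limits at infinity under uniform approximation. -/

section UniformLimits

variable {E : Type*} [NormedAddCommGroup E]

/-- Near infinity, uniform limits of convergent functions converge. -/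
theorem exists_tendsto_of_forall_approx [CompleteSpace E] {f : ℝ → E}
    (hf : ∀ ε : ℝ, 0 < ε → ∃ g : ℝ → E, (∃ a, Tendsto g atTop (𝓝 a)) ∧
      ∀ᶠ t in atTop, ‖f t - g t‖ ≤ ε) : ∃ a, Tendsto f atTop (𝓝 a) := by
  refine cauchy_map_iff_exists_tendsto.1 (Metric.cauchy_iff.2 ⟨inferInstance, fun ε hε => ?_⟩)
  obtain ⟨g, ⟨a, ha⟩, hfg⟩ := hf (ε / 4) (by positivity)
  have h1 : ∀ᶠ t in atTop, ‖f t - a‖ < ε / 2 := by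
    filter_upwards [hfg, (Metric.tendsto_nhds.1 ha) (ε / 4) (by positivity)] with t h1 h2
    rw [dist_eq_norm] at h2
    exact (norm_sub_le_norm_sub_add_norm_sub _ (g t) _).trans_lt (by linarith)
  refine ⟨Metric.ball a (ε / 2), ?_, fun x hx y hy => ?_⟩
  · rw [mem_map]
    filter_upwards [h1] with t ht
    rwa [Set.mem_preimage, Metric.mem_ball, dist_eq_norm]
  · have := dist_triangle_right x y a
    rw [Metric.mem_ball] at hx hy
    linarith

theorem tendsto_zero_of_forall_approx {f : ℝ → E}
    (hf : ∀ ε : ℝ, 0 < ε → ∃ g : ℝ → E, Tendsto g atTop (𝓝 0) ∧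
      ∀ᶠ t in atTop, ‖f t - g t‖ ≤ ε) : Tendsto f atTop (𝓝 0) := by
  refine Metric.tendsto_nhds.2 fun ε hε => ?_
  obtain ⟨g, hg, hfg⟩ := hf (ε / 2) (half_pos hε)
  filter_upwards [hfg, (Metric.tendsto_nhds.1 hg) (ε / 2) (half_pos hε)] with t h1 h2
  rw [dist_zero_right] at h2 ⊢
  calc ‖f t‖ = ‖(f t - g t) + g t‖ := by rw [sub_add_cancel]
    _ < ε := (norm_add_le _ _).trans_lt (by linarith)

end UniformLimits

/-! ### The triangular semigroup, its generator and its asymptotics. -/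

section TriangularSemigroup

variable {X Xb : Type*} [NormedAddCommGroup X] [NormedSpace ℂ X]
  [NormedAddCommGroup Xb] [NormedSpace ℂ Xb]
  {T₀ : ℝ → X →L[ℂ] X} {G Dbar : Xb →L[ℂ] X} {TD : ℝ → Xb →L[ℂ] Xb}
  {T : ℝ → X × Xb →L[ℂ] X × Xb}

/-- At nonnegative times, `T` is the triangular operator matrix with diagonal entries `T₀`, `TD`
and upper right entry `V + Dbar TD - T₀ Dbar`, where `V` is the convolution. -/
def IsTriangular (T₀ : ℝ → X →L[ℂ] X) (G Dbar : Xb →L[ℂ] X) (TD : ℝ → Xb →L[ℂ] Xb)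
    (T : ℝ → X × Xb →L[ℂ] X × Xb) : Prop :=
  ∀ t : ℝ, 0 ≤ t → ∀ (x : X) (y : Xb),
    T t (x, y) = (T₀ t (x - Dbar y) + convFamily T₀ G TD t y + Dbar (TD t y), TD t y)

theorem exists_isTriangular (G Dbar : Xb →L[ℂ] X) (hT₀ : IsC0Semigroup T₀)
    (hb : IsBoundedSemigroup T₀) (hTD : IsC0Semigroup TD) (hs : IsUniformlyExpStable TD) :
    ∃ T : ℝ → X × Xb →L[ℂ] X × Xb, IsTriangular T₀ G Dbar TD T := by
  obtain ⟨M, hM⟩ := id hb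
  obtain ⟨N, ω, hω, hN⟩ := id hs
  -- Additivity and the norm bound are available only for `t ≥ 0`, hence the clamped time.
  let V : ℝ → Xb →L[ℂ] X := fun t => LinearMap.mkContinuous
    { toFun := convFamily T₀ G TD (max t 0)
      map_add' := convFamily_add_right hT₀ hb hTD (le_max_right _ _)
      map_smul' := fun c y => convFamily_smul c _ y }
    (M * ‖G‖ * N * ω⁻¹) (norm_convFamily_le hM hω hN (le_max_right _ _))
  refine ⟨fun t => ((T₀ t).comp (ContinuousLinearMap.fst ℂ X Xb -
    Dbar.comp (ContinuousLinearMap.snd ℂ X Xb)) + (V t).comp (ContinuousLinearMap.snd ℂ X Xb) +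
      (Dbar.comp (TD t)).comp (ContinuousLinearMap.snd ℂ X Xb)).prod
      ((TD t).comp (ContinuousLinearMap.snd ℂ X Xb)), fun t ht x y => ?_⟩
  have hV : V t y = convFamily T₀ G TD t y := by
    change convFamily T₀ G TD (max t 0) y = _
    rw [max_eq_left ht]
  rw [← hV]
  rfl

namespace IsTriangular

theorem upperRight_eq (h : IsTriangular T₀ G Dbar TD T) {t : ℝ} (ht : 0 ≤ t) (y : Xb) :
    upperRight T t y = convFamily T₀ G TD t y + Dbar (TD t y) - T₀ t (Dbar y) := by
  simp only [upperRight, h t ht, zero_sub, map_neg]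
  abel

theorem isC0Semigroup (h : IsTriangular T₀ G Dbar TD T) [CompleteSpace X]
    (hT₀ : IsC0Semigroup T₀) (hb : IsBoundedSemigroup T₀) (hTD : IsC0Semigroup TD) :
    IsC0Semigroup T where
  map_zero := by
    refine ContinuousLinearMap.ext fun ⟨x, y⟩ => ?_
    simp [h 0 le_rfl, convFamily_zero_left, hT₀.map_zero, hTD.map_zero]
  map_add s t hs ht := by
    refine ContinuousLinearMap.ext fun ⟨x, y⟩ => ?_
    rw [ContinuousLinearMap.comp_apply, h _ (add_nonneg hs ht), h t ht, h s hs,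
      convFamily_add hT₀ hb hTD hs ht, hT₀.apply_add hs ht, hTD.apply_add hs ht,
      add_sub_cancel_right, map_add]
    simp only [add_assoc]
  strongly_continuous := by
    rintro ⟨x, y⟩
    refine ContinuousOn.congr ?_ fun t ht => h t ht x y
    exact (((hT₀.strongly_continuous _).add (continuousOn_convFamily hT₀ hb hTD y)).add
      (Dbar.continuous.comp_continuousOn (hTD.strongly_continuous y))).prodMk
      (hTD.strongly_continuous y)

/-- The generator of the triangular semigroup. -/
theorem tendsto_iff (h : IsTriangular T₀ G Dbar TD T) [CompleteSpace X]
    (hT₀ : IsC0Semigroup T₀) (hb : IsBoundedSemigroup T₀) (hTD : IsC0Semigroup TD)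
    (u v : X) (x z : Xb) :
    Tendsto (fun t : ℝ => ((t⁻¹ : ℝ) : ℂ) • (T t (u, x) - (u, x))) (𝓝[>] 0) (𝓝 (v, z)) ↔
      Tendsto (fun t : ℝ => ((t⁻¹ : ℝ) : ℂ) • (T₀ t (u - Dbar x) - (u - Dbar x))) (𝓝[>] 0)
        (𝓝 (v - Dbar z - G x)) ∧
      Tendsto (fun t : ℝ => ((t⁻¹ : ℝ) : ℂ) • (TD t x - x)) (𝓝[>] 0) (𝓝 z) := by
  rw [Prod.tendsto_iff]
  have h1 : ∀ᶠ t : ℝ in 𝓝[>] 0, (((t⁻¹ : ℝ) : ℂ) • (T t (u, x) - (u, x))).1 =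
      ((t⁻¹ : ℝ) : ℂ) • (T₀ t (u - Dbar x) - (u - Dbar x)) +
        ((t⁻¹ : ℝ) : ℂ) • convFamily T₀ G TD t x + Dbar (((t⁻¹ : ℝ) : ℂ) • (TD t x - x)) := by
    filter_upwards [self_mem_nhdsWithin] with t ht
    rw [h t (le_of_lt ht), map_smul, ← smul_add, ← smul_add, Prod.smul_fst, Prod.fst_sub]
    congr 1
    simp only [map_sub]
    abel
  have h2 : ∀ᶠ t : ℝ in 𝓝[>] 0, (((t⁻¹ : ℝ) : ℂ) • (T t (u, x) - (u, x))).2 =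
      ((t⁻¹ : ℝ) : ℂ) • (TD t x - x) := by
    filter_upwards [self_mem_nhdsWithin] with t ht
    rw [h t (le_of_lt ht), Prod.smul_snd, Prod.snd_sub]
  rw [tendsto_congr' h1, tendsto_congr' h2]
  -- Once the boundary quotient converges, the `Dbar` and convolution terms converge to `Dbar z` and
  -- `G x`, so the first component converges exactly when the `T₀` quotient does.
  refine and_congr_left fun hz => ?_
  have hV := tendsto_convFamily_div (G := G) hT₀ hb hTD x
  have hD := (Dbar.continuous.tendsto z).comp hz
  constructor
  · intro hv
    refine ((hv.sub hD).sub hV).congr fun t => ?_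
    simp only [Function.comp_apply]
    abel
  · intro hw
    have := (hw.add hV).add hD
    rw [sub_add_cancel, sub_add_cancel] at this
    exact this

theorem isBoundedSemigroup (h : IsTriangular T₀ G Dbar TD T)
    (hb : IsBoundedSemigroup T₀) (hs : IsUniformlyExpStable TD) : IsBoundedSemigroup T := by
  obtain ⟨M, hM⟩ := id hb
  obtain ⟨N, ω, hω, hN⟩ := id hs
  obtain ⟨N', hN'⟩ := hs.isBoundedSemigroup
  have hM0 : 0 ≤ M := (norm_nonneg _).trans (hM 0 le_rfl)
  have hN0 : 0 ≤ N := by simpa using (norm_nonneg _).trans (hN 0 le_rfl)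
  have hN0' : 0 ≤ N' := (norm_nonneg _).trans (hN' 0 le_rfl)
  refine ⟨max (M * (1 + ‖Dbar‖) + M * ‖G‖ * N * ω⁻¹ + ‖Dbar‖ * N') N', fun t ht =>
    ContinuousLinearMap.opNorm_le_bound _ (le_max_of_le_right hN0') ?_⟩
  rintro ⟨x, y⟩
  have hx : ‖x‖ ≤ ‖(x, y)‖ := le_max_left _ _
  have hy : ‖y‖ ≤ ‖(x, y)‖ := le_max_right _ _
  set r := ‖(x, y)‖
  rw [h t ht, max_mul_of_nonneg _ _ (norm_nonneg _)]
  refine max_le_max ?_ ((TD t).le_of_opNorm_le_of_le (hN' t ht) hy)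
  have h1 : ‖T₀ t (x - Dbar y)‖ ≤ M * (r + ‖Dbar‖ * r) :=
    (T₀ t).le_of_opNorm_le_of_le (hM t ht)
      ((norm_sub_le _ _).trans (add_le_add hx (Dbar.le_of_opNorm_le_of_le le_rfl hy)))
  have h2 : ‖convFamily T₀ G TD t y‖ ≤ M * ‖G‖ * N * ω⁻¹ * r :=
    (norm_convFamily_le hM hω hN ht y).trans (by gcongr)
  have h3 : ‖Dbar (TD t y)‖ ≤ ‖Dbar‖ * (N' * r) :=
    Dbar.le_of_opNorm_le_of_le le_rfl ((TD t).le_of_opNorm_le_of_le (hN' t ht) hy)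
  calc _ ≤ _ := norm_add₃_le
    _ ≤ _ := add_le_add_three h1 h2 h3
    _ = _ := by ring

theorem isUniformlyExpStable (h : IsTriangular T₀ G Dbar TD T)
    (hs₀ : IsUniformlyExpStable T₀) (hs : IsUniformlyExpStable TD) :
    IsUniformlyExpStable T := by
  obtain ⟨M, α, hα, hM⟩ := hs₀
  obtain ⟨N, ω, hω, hN⟩ := hs
  have hM0 : 0 ≤ M := by simpa using (norm_nonneg _).trans (hM 0 le_rfl)
  have hN0 : 0 ≤ N := by simpa using (norm_nonneg _).trans (hN 0 le_rfl)
  -- Both decay rates are lowered to a common one, as `norm_convFamily_le_exp` demands.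
  set a := min α ω
  have ha : 0 < a := lt_min hα hω
  replace hM : ∀ t : ℝ, 0 ≤ t → ‖T₀ t‖ ≤ M * Real.exp (-a * t) := fun t ht =>
    (hM t ht).trans (by gcongr; exact min_le_left _ _)
  replace hN : ∀ t : ℝ, 0 ≤ t → ‖TD t‖ ≤ N * Real.exp (-a * t) := fun t ht =>
    (hN t ht).trans (by gcongr; exact min_le_right _ _)
  refine ⟨max (M * (1 + ‖Dbar‖) + M * ‖G‖ * N * (2 / a) + ‖Dbar‖ * N) N, a / 2, half_pos ha,
    fun t ht => ContinuousLinearMap.opNorm_le_bound _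
      (mul_nonneg (le_max_of_le_right hN0) (Real.exp_pos _).le) ?_⟩
  rintro ⟨x, y⟩
  have hx : ‖x‖ ≤ ‖(x, y)‖ := le_max_left _ _
  have hy : ‖y‖ ≤ ‖(x, y)‖ := le_max_right _ _
  set r := ‖(x, y)‖
  have hexp : Real.exp (-a * t) ≤ Real.exp (-(a / 2) * t) :=
    Real.exp_le_exp.2 (by nlinarith)
  replace hN : ‖TD t‖ ≤ N * Real.exp (-(a / 2) * t) ∧ ‖convFamily T₀ G TD t y‖ ≤
      M * ‖G‖ * N * (2 / a) * Real.exp (-(a / 2) * t) * r :=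
    ⟨(hN t ht).trans (by gcongr),
      (norm_convFamily_le_exp ha hM hN ht y).trans (by gcongr)⟩
  replace hM := (hM t ht).trans (mul_le_mul_of_nonneg_left hexp hM0)
  set q := Real.exp (-(a / 2) * t)
  obtain ⟨hN, h2⟩ := hN
  rw [h t ht, max_mul_of_nonneg _ _ (Real.exp_pos _).le, max_mul_of_nonneg _ _ (norm_nonneg _)]
  refine max_le_max ?_ ((TD t).le_of_opNorm_le_of_le hN hy)
  have h1 : ‖T₀ t (x - Dbar y)‖ ≤ M * q * (r + ‖Dbar‖ * r) :=
    (T₀ t).le_of_opNorm_le_of_le hM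
      ((norm_sub_le _ _).trans (add_le_add hx (Dbar.le_of_opNorm_le_of_le le_rfl hy)))
  have h3 : ‖Dbar (TD t y)‖ ≤ ‖Dbar‖ * (N * q * r) :=
    Dbar.le_of_opNorm_le_of_le le_rfl ((TD t).le_of_opNorm_le_of_le hN hy)
  calc _ ≤ _ := norm_add₃_le
    _ ≤ _ := add_le_add_three h1 h2 h3
    _ = _ := by ring

end IsTriangular

theorem IsUniformlyExpStable.strongLimitZero (hs : IsUniformlyExpStable TD) :
    StrongLimitZero TD := by
  obtain ⟨N, ω, hω, hN⟩ := hs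
  intro y
  have h1 : Tendsto (fun t : ℝ => Real.exp (-ω * t)) atTop (𝓝 0) :=
    Real.tendsto_exp_atBot.comp (tendsto_id.const_mul_atTop_of_neg (neg_lt_zero.2 hω))
  have h2 : Tendsto (fun t : ℝ => N * Real.exp (-ω * t) * ‖y‖) atTop (𝓝 0) := by
    simpa using (h1.const_mul N).mul_const ‖y‖
  refine squeeze_zero_norm' ?_ h2
  filter_upwards [eventually_ge_atTop 0] with t ht
  exact (TD t).le_of_opNorm_le (hN t ht) y

/-- Pointwise convergence implies convergence to a bounded operator. -/
theorem strongLimitExists_of_forall_exists_tendsto {E : Type*} [NormedAddCommGroup E]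
    [NormedSpace ℂ E] [CompleteSpace E] {T : ℝ → E →L[ℂ] E}
    (h : ∀ x, ∃ a, Tendsto (fun t => T t x) atTop (𝓝 a)) : StrongLimitExists T := by
  choose P hP using h
  -- Boundedness of the limit operator is the Banach–Steinhaus theorem.
  exact ⟨continuousLinearMapOfTendsto T (tendsto_pi_nhds.2 hP), hP⟩

theorem isEventuallyApproxTrig_convFamily [CompleteSpace X] (hT₀ : IsC0Semigroup T₀)
    (hb : IsBoundedSemigroup T₀) (hTD : IsC0Semigroup TD) (hs : IsUniformlyExpStable TD)
    (h₀ : IsAsymptoticallyAlmostPeriodicFamily (fun t x => T₀ t x)) (y : Xb) :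
    IsEventuallyApproxTrig (fun t => convFamily T₀ G TD t y) := by
  refine .of_forall_approx fun ε hε => ?_
  obtain ⟨s, -, h⟩ := exists_norm_convFamily_sub_le (G := G) hT₀ hb hTD hs y hε
  exact ⟨_, ((h₀ (convFamily T₀ G TD s y)).isEventuallyApproxTrig.comp_sub s),
    (eventually_ge_atTop s).mono h⟩

theorem exists_tendsto_convFamily [CompleteSpace X] (hT₀ : IsC0Semigroup T₀)
    (hb : IsBoundedSemigroup T₀) (hTD : IsC0Semigroup TD) (hs : IsUniformlyExpStable TD)
    (h₀ : StrongLimitExists T₀) (y : Xb) :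
    ∃ a, Tendsto (fun t => convFamily T₀ G TD t y) atTop (𝓝 a) := by
  obtain ⟨P, hP⟩ := h₀
  refine exists_tendsto_of_forall_approx fun ε hε => ?_
  obtain ⟨s, -, h⟩ := exists_norm_convFamily_sub_le (G := G) hT₀ hb hTD hs y hε
  exact ⟨_, ⟨_, (hP (convFamily T₀ G TD s y)).comp
    (tendsto_atTop_add_const_right atTop (-s) tendsto_id)⟩, (eventually_ge_atTop s).mono h⟩

theorem tendsto_convFamily_zero [CompleteSpace X] (hT₀ : IsC0Semigroup T₀)
    (hb : IsBoundedSemigroup T₀) (hTD : IsC0Semigroup TD) (hs : IsUniformlyExpStable TD)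
    (h₀ : StrongLimitZero T₀) (y : Xb) :
    Tendsto (fun t => convFamily T₀ G TD t y) atTop (𝓝 0) := by
  refine tendsto_zero_of_forall_approx fun ε hε => ?_
  obtain ⟨s, -, h⟩ := exists_norm_convFamily_sub_le (G := G) hT₀ hb hTD hs y hε
  exact ⟨_, (h₀ (convFamily T₀ G TD s y)).comp
    (tendsto_atTop_add_const_right atTop (-s) tendsto_id), (eventually_ge_atTop s).mono h⟩

end TriangularSemigroup

theorem mem_graph_iff_exists {E F : Type*} [AddCommGroup E] [Module ℂ E] [AddCommGroup F]
    [Module ℂ F] {f : E →ₗ.[ℂ] F} {x : E} {y : F} :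
    (x, y) ∈ f.graph ↔ ∃ h : x ∈ f.domain, f ⟨x, h⟩ = y := by
  rw [LinearPMap.mem_graph_iff]
  exact ⟨fun ⟨a, ha, hb⟩ => by subst ha; exact ⟨a.2, hb⟩, fun ⟨h, hb⟩ => ⟨⟨x, h⟩, rfl, hb⟩⟩

/-! ### Decoupling the operator matrix. -/

namespace CoupledSystem

variable {X Xb Yb : Type*} [NormedAddCommGroup X] [NormedSpace ℂ X]
  [NormedAddCommGroup Xb] [NormedSpace ℂ Xb] [NormedAddCommGroup Yb] [NormedSpace ℂ Yb]
  {S : CoupledSystem X Xb Yb} {G Dbar : Xb →L[ℂ] X}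

theorem mem_Dpart_domain {x : Xb} :
    x ∈ S.Dpart.domain ↔ x ∈ S.D.domain ∧ x ∈ Set.range S.emb := by
  rw [Dpart, LinearPMap.domRestrict_domain, Submodule.mem_inf, and_comm]
  rfl

theorem mem_Dpart_graph {x z : Xb} : (x, z) ∈ S.Dpart.graph ↔
    ∃ hx : x ∈ S.D.domain, x ∈ Set.range S.emb ∧ S.D ⟨x, hx⟩ = z := by
  rw [mem_graph_iff_exists]
  constructor
  · rintro ⟨h, rfl⟩
    exact ⟨(mem_Dpart_domain.1 h).1, (mem_Dpart_domain.1 h).2,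
      (LinearPMap.domRestrict_apply rfl).symm⟩
  · rintro ⟨h, h', rfl⟩
    exact ⟨mem_Dpart_domain.2 ⟨h, h'⟩, LinearPMap.domRestrict_apply rfl⟩

theorem mem_A₀_graph {w a : X} : (w, a) ∈ S.A₀.graph ↔
    ∃ hw : w ∈ S.A.domain, S.L ⟨w, hw⟩ = 0 ∧ S.A ⟨w, hw⟩ = a := by
  rw [mem_graph_iff_exists]
  constructor
  · rintro ⟨h, rfl⟩
    obtain ⟨h', hL⟩ := mem_restrictKer_domain.1 h
    exact ⟨h', hL, (restrictKer_apply h h').symm⟩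
  · rintro ⟨h', hL, rfl⟩
    exact ⟨mem_restrictKer_domain.2 ⟨h', hL⟩, restrictKer_apply _ h'⟩

theorem FeedbackBounded.isDirichletSolution (hS : S.FeedbackBounded Dbar) (y : Yb) :
    IsDirichletSolution S.A S.L 0 y (Dbar (S.emb y)) := by
  rw [hS.extends_dirichletOp]
  exact dirichletOp_spec S.L_surjective hS.A₀_invertible y

theorem mem_matrixOp_graph {u v : X} {x z : Xb} : ((u, x), (v, z)) ∈ S.matrixOp.graph ↔
    ∃ (hu : u ∈ S.A.domain) (hx : x ∈ S.D.domain), S.emb (S.L ⟨u, hu⟩) = x ∧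
      S.A ⟨u, hu⟩ + S.B ⟨x, S.D_le_B hx⟩ = v ∧ S.C ⟨u, S.A_le_C hu⟩ + S.D ⟨x, hx⟩ = z := by
  rw [mem_graph_iff_exists]
  constructor
  · rintro ⟨⟨hx, hu, hL⟩, h⟩
    exact ⟨hu, hx, hL, congrArg Prod.fst h, congrArg Prod.snd h⟩
  · rintro ⟨hu, hx, hL, rfl, rfl⟩
    exact ⟨⟨hx, hu, hL⟩, rfl⟩

/-- Subtracting the Dirichlet solution decouples the domain of the operator matrix. -/
theorem mem_matrixOp_graph_iff (hS : S.FeedbackBounded Dbar)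
    (hC : ∀ u : S.C.domain, S.C u = 0) (hG : S.IsFeedbackExtension Dbar G)
    {u v : X} {x z : Xb} : ((u, x), (v, z)) ∈ S.matrixOp.graph ↔
      (u - Dbar x, v - Dbar z - G x) ∈ S.A₀.graph ∧ (x, z) ∈ S.Dpart.graph := by
  rw [mem_matrixOp_graph, mem_A₀_graph, mem_Dpart_graph]
  constructor
  · rintro ⟨hu, hx, rfl, rfl, rfl⟩
    obtain ⟨hd, hAd, hLd⟩ := hS.isDirichletSolution (S.L ⟨u, hu⟩)
    refine ⟨⟨S.A.domain.sub_mem hu hd, ?_, ?_⟩, hx, ⟨_, rfl⟩, by rw [hC, zero_add]⟩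
    · refine (S.L.map_sub ⟨u, hu⟩ ⟨_, hd⟩).trans ?_
      rw [hLd, sub_self]
    · refine (S.A.map_sub ⟨u, hu⟩ ⟨_, hd⟩).trans ?_
      -- As `A` kills `Dbar x` and `G x = B x - Dbar z`, both sides reduce to `A u`.
      rw [hAd, hG _ hx ⟨_, rfl⟩, hC]
      simp
  · rintro ⟨⟨hw, hLw, hAw⟩, hx, ⟨y, rfl⟩, rfl⟩
    obtain ⟨hd, hAd, hLd⟩ := hS.isDirichletSolution y
    have hsum : (⟨u - Dbar (S.emb y), hw⟩ : S.A.domain) + ⟨_, hd⟩ =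
        ⟨u, by simpa using S.A.domain.add_mem hw hd⟩ := Subtype.ext (sub_add_cancel _ _)
    refine ⟨by simpa using S.A.domain.add_mem hw hd, hx, ?_, ?_, by rw [hC, zero_add]⟩
    · rw [← hsum, map_add, hLw, hLd, zero_add]
    · rw [← hsum, S.A.map_add, hAw, hAd, hG _ hx ⟨_, rfl⟩]
      simp

/-- Extension by continuity: existence uses completeness of `X`, uniqueness only density of the
domain, which holds for a generator. -/
theorem FeedbackBounded.existsUnique_isFeedbackExtension [CompleteSpace X]
    (hS : S.FeedbackBounded Dbar) (hd : Dense (S.Dpart.domain : Set Xb)) :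
    ∃! G : Xb →L[ℂ] X, S.IsFeedbackExtension Dbar G := by
  have hle : S.Dpart.domain ≤ S.D.domain := fun x hx => (mem_Dpart_domain.1 hx).1
  let f : S.Dpart.domain →ₗ[ℂ] X :=
    S.B.toFun ∘ₗ Submodule.inclusion (hle.trans S.D_le_B) -
      (Dbar : Xb →ₗ[ℂ] X) ∘ₗ S.D.toFun ∘ₗ Submodule.inclusion hle
  have hf : ∃ K, ∀ x, ‖f x‖ ≤ K * ‖S.Dpart.domain.subtype x‖ := by
    obtain ⟨K, hK⟩ := hS.bounded
    exact ⟨K, fun x => hK x (hle x.2) (mem_Dpart_domain.1 x.2).2⟩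
  have hr : DenseRange S.Dpart.domain.subtype := by simpa [DenseRange] using hd
  have hG : S.IsFeedbackExtension Dbar (f.extendOfNorm S.Dpart.domain.subtype) :=
    fun x hx hx' => LinearMap.extendOfNorm_eq hr hf ⟨x, mem_Dpart_domain.2 ⟨hx, hx'⟩⟩
  refine ⟨_, hG, fun G' hG' => ?_⟩
  refine ContinuousLinearMap.ext_on (s := (S.Dpart.domain : Set Xb)) (by
    rw [Submodule.span_eq]; exact hd) fun x hx => ?_
  obtain ⟨h, h'⟩ := mem_Dpart_domain.1 hx
  exact (hG' x h h').trans (hG x h h').symm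

/-- Triangular semigroups are generated by the operator matrix. -/
theorem generates_matrixOp [CompleteSpace X] (hS : S.FeedbackBounded Dbar)
    (hC : ∀ u : S.C.domain, S.C u = 0) (hG : S.IsFeedbackExtension Dbar G)
    {T₀ : ℝ → X →L[ℂ] X} (hT₀ : Generates S.A₀ T₀) (hb : IsBoundedSemigroup T₀)
    {TD : ℝ → Xb →L[ℂ] Xb} (hTD : Generates S.Dpart TD)
    {T : ℝ → X × Xb →L[ℂ] X × Xb} (hT : IsTriangular T₀ G Dbar TD T) :
    Generates S.matrixOp T := by
  refine ⟨hT.isC0Semigroup hT₀.1 hb hTD.1, ?_⟩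
  rintro ⟨u, x⟩ ⟨v, z⟩
  rw [mem_matrixOp_graph_iff hS hC hG, hT.tendsto_iff hT₀.1 hb hTD.1, hT₀.2, hTD.2]

end CoupledSystem

end CoupledMatrix

/-! ### Assembly of the main theorem. -/

open CoupledMatrix CoupledSystem in
theorem mainTheorem9
    {X Xb Yb : Type*}
    [NormedAddCommGroup X] [NormedSpace ℂ X] [CompleteSpace X]
    [NormedAddCommGroup Xb] [NormedSpace ℂ Xb] [CompleteSpace Xb]
    [NormedAddCommGroup Yb] [NormedSpace ℂ Yb] [CompleteSpace Yb]
    (S : CoupledMatrix.CoupledSystem X Xb Yb)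
    (Dbar : Xb →L[ℂ] X) (hS : S.FeedbackBounded Dbar)
    (hC : ∀ u : S.C.domain, S.C u = 0)
    (T₀ : ℝ → X →L[ℂ] X) (hT₀ : CoupledMatrix.Generates S.A₀ T₀)
    (hT₀_bdd : CoupledMatrix.IsBoundedSemigroup T₀)
    (TD : ℝ → Xb →L[ℂ] Xb) (hTD : CoupledMatrix.Generates S.Dpart TD)
    (hTD_stable : CoupledMatrix.IsUniformlyExpStable TD) :
    -- the matrix generates a semigroup
    (∃ T : ℝ → X × Xb →L[ℂ] X × Xb, CoupledMatrix.Generates S.matrixOp T) ∧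
    -- `B - Dbar D` extends uniquely to a bounded operator `G`
    (∃! G : Xb →L[ℂ] X, S.IsFeedbackExtension Dbar G) ∧
    -- the semigroup is upper triangular, with the following properties
    ∀ G : Xb →L[ℂ] X, S.IsFeedbackExtension Dbar G →
      ∀ T : ℝ → X × Xb →L[ℂ] X × Xb, CoupledMatrix.Generates S.matrixOp T →
        (∀ t : ℝ, 0 ≤ t → ∀ (x : X) (y : Xb),
          T t (x, y) = (T₀ t x + CoupledMatrix.upperRight T t y, TD t y) ∧
          CoupledMatrix.upperRight T t y =
            CoupledMatrix.convFamily T₀ G TD t y + Dbar (TD t y) - T₀ t (Dbar y)) ∧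
        CoupledMatrix.IsBoundedSemigroup T ∧
        (CoupledMatrix.IsAsymptoticallyAlmostPeriodicFamily (fun t x => T₀ t x) →
          CoupledMatrix.IsAsymptoticallyAlmostPeriodicFamily
            (CoupledMatrix.convFamily T₀ G TD) ∧
          CoupledMatrix.IsAsymptoticallyAlmostPeriodicFamily (CoupledMatrix.upperRight T) ∧
          CoupledMatrix.IsAsymptoticallyAlmostPeriodicFamily (fun t p => T t p)) ∧
        (CoupledMatrix.StrongLimitExists T₀ → CoupledMatrix.StrongLimitExists T) ∧
        (CoupledMatrix.StrongLimitZero T₀ → CoupledMatrix.StrongLimitZero T) ∧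
        (CoupledMatrix.IsUniformlyExpStable T₀ → CoupledMatrix.IsUniformlyExpStable T) := by
  have hex := hS.existsUnique_isFeedbackExtension hTD.dense_domain
  refine ⟨?_, hex, fun G hG T hT => ?_⟩
  · obtain ⟨G, hG, -⟩ := hex
    obtain ⟨T, hT⟩ := exists_isTriangular G Dbar hT₀.1 hT₀_bdd hTD.1 hTD_stable
    exact ⟨T, generates_matrixOp hS hC hG hT₀ hT₀_bdd hTD hT⟩
  -- The given `T` is not known to be bounded; uniqueness needs this only for the constructed `T'`.
  have htri : IsTriangular T₀ G Dbar TD T := by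
    obtain ⟨T', hT'⟩ := exists_isTriangular G Dbar hT₀.1 hT₀_bdd hTD.1 hTD_stable
    have hgen := generates_matrixOp hS hC hG hT₀ hT₀_bdd hTD hT'
    intro t ht x y
    rw [← hgen.eq_of_isBoundedSemigroup (hT'.isBoundedSemigroup hT₀_bdd hTD_stable) hT ht,
      hT' t ht]
  have hTD0 := hTD_stable.strongLimitZero
  have hDTD0 : ∀ y, Tendsto (fun t => Dbar (TD t y)) atTop (𝓝 0) := fun y => by
    have := (Dbar.continuous.tendsto 0).comp (hTD0 y)
    rwa [map_zero] at this
  have hev : ∀ x y, (fun t => (T₀ t (x - Dbar y) + convFamily T₀ G TD t y + Dbar (TD t y),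
      TD t y)) =ᶠ[atTop] fun t => T t (x, y) := fun x y => by
    filter_upwards [eventually_ge_atTop 0] with t ht
    exact (htri t ht x y).symm
  refine ⟨fun t ht x y => ⟨?_, htri.upperRight_eq ht y⟩,
    htri.isBoundedSemigroup hT₀_bdd hTD_stable, fun h₀ => ?_, fun h₀ => ?_, fun h₀ => ?_,
    fun h₀ => htri.isUniformlyExpStable h₀ hTD_stable⟩
  · rw [htri t ht, htri.upperRight_eq ht, map_sub]
    congr 1
    abel
  · have hV := isEventuallyApproxTrig_convFamily (G := G) hT₀.1 hT₀_bdd hTD.1 hTD_stable h₀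
    have hTp : IsAsymptoticallyAlmostPeriodicFamily (fun t p => T t p) := by
      rintro ⟨x, y⟩
      refine IsEventuallyApproxTrig.isAsymptoticallyAlmostPeriodic ?_
        (hT.1.strongly_continuous (x, y))
      have h1 := (((h₀ (x - Dbar y)).isEventuallyApproxTrig.add (hV y)).add
        (.of_tendsto_zero (hDTD0 y))).clm_comp (ContinuousLinearMap.inl ℂ X Xb)
      have h2 := (IsEventuallyApproxTrig.of_tendsto_zero (hTD0 y)).clm_comp
        (ContinuousLinearMap.inr ℂ X Xb)
      refine (h1.add h2).congr' (EventuallyEq.trans (.of_forall fun t => ?_) (hev x y))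
      simp
    refine ⟨fun y => (hV y).isAsymptoticallyAlmostPeriodic
      (continuousOn_convFamily hT₀.1 hT₀_bdd hTD.1 y), fun y => ?_, hTp⟩
    -- The corner is the first component of the orbit of `(0, y)`, so its almost periodicity and
    -- continuity come from `T`.
    refine IsEventuallyApproxTrig.isAsymptoticallyAlmostPeriodic
      ((hTp (0, y)).isEventuallyApproxTrig.clm_comp (ContinuousLinearMap.fst ℂ X Xb)) ?_
    exact continuous_fst.comp_continuousOn (hT.1.strongly_continuous (0, y))
  · refine strongLimitExists_of_forall_exists_tendsto fun ⟨x, y⟩ => ?_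
    obtain ⟨a, ha⟩ := exists_tendsto_convFamily (G := G) hT₀.1 hT₀_bdd hTD.1 hTD_stable h₀ y
    obtain ⟨P, hP⟩ := h₀
    exact ⟨_, ((((hP (x - Dbar y)).add ha).add (hDTD0 y)).prodMk_nhds (hTD0 y)).congr' (hev x y)⟩
  · rintro ⟨x, y⟩
    have ha := tendsto_convFamily_zero (G := G) hT₀.1 hT₀_bdd hTD.1 hTD_stable h₀ y
    have := ((((h₀ (x - Dbar y)).add ha).add (hDTD0 y)).prodMk_nhds (hTD0 y)).congr' (hev x y)
    rwa [add_zero, add_zero, Prod.mk_zero_zero] at this
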